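/- **Setting.** Let $n\ge 1$, $V=\mathbb C^n$ with standard basis $e_1,\dots,e_n$. A *linear relation* $P:V\rightrightarrows V$ is a subspace $P\subset V\oplus V$; its domain $\operatorname{Dom}P$ and image $\operatorname{Im}P$ are its projections to the first and the second summand, $\operatorname{Ker}P=P\cap(V\oplus 0)$ and $\operatorname{Indef}P=P\cap(0\oplus V)$ (regarded as subspaces of $V$). Operators are identified with their graphs, and $\mathrm{Gr}_n$ is the Grassmannian of $n$-dimensional subspaces of $V\oplus V$. A *hinge* is a family $\mathcal P=(P_1,\dots,P_k)$, $k\ge1$, of elements of $\mathrm{Gr}_n$ with $\operatorname{Ker}P_j=\operatorname{Dom}P_{j+1}$ and $\operatorname{Im}P_j=\operatorname{Indef}P_{j+1}$ for $1\le j<k$, $\operatorname{Dom}P_1=V$, $\operatorname{Im}P_k=V$, and $P_j\ne\operatorname{Ker}P_j\oplus\operatorname{Indef}P_j$ for all $j$. **Exterior powers.** Let $S\in\mathrm{Gr}_n$. Choose bases $f_1,\dots,f_p,g_1,\dots,g_r,h_1,\dots,h_s$ and $F_1,\dots,F_p,G_1,\dots,G_r,H_1,\dots,H_s$ of $V$ such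 that $S$ is spanned by the vectors $0\oplus F_i$, $g_i\oplus G_i$, $h_i\oplus0$. Define $\lambda(S):\Lambda V\to\Lambda V$, up to a nonzero factor, by $f_1\wedge\dots\wedge f_p\wedge g_{i_1}\wedge\dots\wedge g_{i_t}\mapsto F_1\wedge\dots\wedge F_p\wedge G_{i_1}\wedge\dots\wedge G_{i_t}$, all the other basis monomials going to $0$; let $\lambda^m(S)$ be its restriction to $\Lambda^mV$. For a hinge $\mathcal P=(P_1,\dots,P_k)$ fix the factors in $\lambda(P_1),\dots,\lambda(P_k)$ by requiring that $\lambda(P_1)$ be the operator $v_1\wedge\dots\wedge v_m\mapsto Av_1\wedge\dots\wedge Av_m$, where $P_1$ is the graph of $A$, and that $\lambda^{d}(P_j)=\lambda^{d}(P_{j+1})$ for $d=\dim\operatorname{Im}P_j$. For $0\le m\le n$ let $\mathcal L^m(\mathcal P):\Lambda^mV\to\Lambda^mV$ be the unique nonzero operator among $\lambda^m(P_1),\dots,\lambda^m(P_k)$, and let $\mathcal L(\mathcal P)=(\mathcal L^0(\mathcal P),\dots,\mathcal L^n(\mathcal P))$. **Representations.** For integers $\nu_1\ge\dots\ge\nu_n\ge0$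 (a signature; $\nu_{n+1}:=0$) and operators $A_j$ on $\Lambda^jV$ put $\mathfrak r_\nu(A)=\bigotimes_{j=1}^n A_j^{\otimes(\nu_j-\nu_{j+1})}$, acting in $\bigotimes_{j=1}^n(\Lambda^jV)^{\otimes(\nu_j-\nu_{j+1})}$. An element $g\in\mathrm{GL}_n(\mathbb C)$ acts here by $\mathfrak r_\nu(\Lambda^1g,\dots,\Lambda^ng)$. Let $H_\nu$ be the $\mathrm{GL}_n(\mathbb C)$-cyclic span of $\bigotimes_j(e_1\wedge\dots\wedge e_j)^{\otimes(\nu_j-\nu_{j+1})}$, and let $\rho_\nu$ be the (irreducible polynomial) representation of $\mathrm{GL}_n(\mathbb C)$ in $H_\nu$; for a hinge $\mathcal P$, $\rho_\nu(\mathcal L(\mathcal P))$ is the restriction of $\mathfrak r_\nu(\mathcal L(\mathcal P))$ to $H_\nu$. Let $\nu^{(1)},\dots,\nu^{(\sigma)}$, $\sigma\ge1$, be signatures, $\zeta=\bigoplus_l\rho_{\nu^{(l)}}$, $Z=\bigoplus_lH_{\nu^{(l)}}$, and let $[\mathrm{GL}_n]_\zeta$ be the closure of the image of $\mathrm{GL}_n(\mathbb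 C)$ under $\zeta$ in $\mathbb P\mathrm{Mat}(Z)$, the projective space of nonzero operators in $Z$ up to nonzero scalars. For integers $\mathbf m=(m_1,\dots,m_n)$ and a hinge $\mathcal P$ put $v^{(l)}=\sum_jm_j\nu^{(l)}_j$, $v=v(\mathbf m)=\max_lv^{(l)}$, and $\zeta(\mathbf m,\mathcal P)=\bigoplus_lB_l$, where $B_l=\rho_{\nu^{(l)}}(\mathcal L(\mathcal P))$ if $v^{(l)}=v$ and $B_l=0$ if $v^{(l)}<v$. **Meromorphic families.** Let $\gamma$ be a meromorphic family: a map from a punctured disk $0<|z|<\varepsilon$ to $\mathrm{GL}_n(\mathbb C)$ whose matrix elements are holomorphic with at most a pole at $0$. Its *exponents* are integers $\hat m_1\ge\dots\ge\hat m_n$ such that $\gamma(z)=a(z)\,\mathrm{diag}(z^{-\hat m_1},\dots,z^{-\hat m_n})\,b(z)$ near $0$, where $a,b$ are holomorphic near $0$ and $a(0),b(0)$ are invertible. The *normalized exponents* $\mathbf m^\gamma$ are the $\hat m_j$ divided by their greatest common divisor ($\mathbf m^\gamma=0$ if all $\hat m_j=0$). With $k_1>\dots>k_\tau$ the distinct values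 of the $\hat m_j$, the *limit hinge* is $\mathcal P^\gamma=(P_1,\dots,P_\tau)$, $P_j=\lim_{z\to0}z^{k_j}\gamma(z)$ in $\mathrm{Gr}_n$. **Lemma 3.6.** The exponents $\hat{\mathbf m}$ and the limit hinge $\mathcal P^\gamma$ of $\gamma$ exist and are unique. The operator $\zeta(\mathbf m^\gamma,\mathcal P^\gamma)$ is nonzero, it defines a point of $[\mathrm{GL}_n]_\zeta$, and the limit of $\zeta(\gamma(z))$ as $z\to0$ in $[\mathrm{GL}_n]_\zeta$ exists and equals this point. Moreover, with the maximal weight $\hat v=v(\hat{\mathbf m})=\max_l\sum_j\hat m_j\nu_j^{(l)}$, $$\lim_{z\to0}z^{\hat v}\bigoplus_l\rho_{\nu^{(l)}}(\gamma(z))=\zeta(\mathbf m^\gamma,\mathcal P^\gamma)\quad\text{in }\mathrm{Mat}(Z).$$ -/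

import Mathlib

open Filter Topology
open scoped TensorProduct

noncomputable section

namespace SeaUrchin

/-! ## Linear relations and the Grassmannian -/

/-- The space `V = ℂⁿ`. -/
abbrev V (n : ℕ) : Type := Fin n → ℂ

/-- The Grassmannian `Gr_n` of `n`-dimensional subspaces of `V ⊕ V`, that is, of the linear
relations `V ⇉ V` of dimension `n`. -/
def Gr (n : ℕ) : Type := {S : Submodule ℂ (V n × V n) // Module.finrank ℂ S = n}

/-- Linearly independent `n`-tuples in `V ⊕ V`. -/
abbrev Frame (n : ℕ) : Type := {u : Fin n → V n × V n // LinearIndependent ℂ u}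

/-- The subspace spanned by a frame. -/
def Frame.span {n : ℕ} (u : Frame n) : Gr n :=
  ⟨Submodule.span ℂ (Set.range u.1), by simpa using finrank_span_eq_card u.2⟩

/-- The usual topology of the Grassmannian: the quotient topology from the space of frames. -/
instance (n : ℕ) : TopologicalSpace (Gr n) := TopologicalSpace.coinduced Frame.span inferInstance

namespace Gr

variable {n : ℕ}

/-- `Dom P`, the projection of `P ⊂ V ⊕ V` to the first summand. -/
def dom (P : Gr n) : Submodule ℂ (V n) := P.1.map (LinearMap.fst ℂ (V n) (V n))

/-- `Im P`, the projection of `P ⊂ V ⊕ V` to the second summand. -/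
def im (P : Gr n) : Submodule ℂ (V n) := P.1.map (LinearMap.snd ℂ (V n) (V n))

/-- `Ker P = P ∩ (V ⊕ 0)`, as a subspace of `V`. -/
def ker (P : Gr n) : Submodule ℂ (V n) := P.1.comap (LinearMap.inl ℂ (V n) (V n))

/-- `Indef P = P ∩ (0 ⊕ V)`, as a subspace of `V`. -/
def indef (P : Gr n) : Submodule ℂ (V n) := P.1.comap (LinearMap.inr ℂ (V n) (V n))

/-- The graph `{v ⊕ A v}` of a linear operator. -/
def graph (A : V n →ₗ[ℂ] V n) : Gr n :=
  ⟨LinearMap.range (LinearMap.prod LinearMap.id A), by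
    rw [LinearMap.finrank_range_of_inj (fun x y h => by simpa using congrArg Prod.fst h)]
    simp⟩

end Gr

/-! ## Hinges -/

/-- A hinge `(P_1, …, P_k)` in `V = ℂⁿ` (indexed here by `0, …, k - 1`). -/
@[ext] structure Hinge (n : ℕ) where
  k : ℕ
  k_pos : 0 < k
  P : Fin k → Gr n
  ker_eq_dom : ∀ (j : ℕ) (hj : j + 1 < k),
    (P ⟨j, Nat.lt_of_succ_lt hj⟩).ker = (P ⟨j + 1, hj⟩).dom
  im_eq_indef : ∀ (j : ℕ) (hj : j + 1 < k),
    (P ⟨j, Nat.lt_of_succ_lt hj⟩).im = (P ⟨j + 1, hj⟩).indef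
  dom_first : (P ⟨0, k_pos⟩).dom = ⊤
  im_last : (P ⟨k - 1, Nat.sub_lt k_pos Nat.one_pos⟩).im = ⊤
  ne_split : ∀ j, (P j).1 ≠ (P j).ker.prod (P j).indef

/-! ## Operators in exterior powers -/

/-- Families of operators `A_m : Λ^m V → Λ^m V`, `m = 0, 1, 2, …` (for `m > n` the space
`Λ^m V` is zero). -/
abbrev ExtFamily (n : ℕ) : Type := ∀ m : ℕ, Module.End ℂ (⋀[ℂ]^m (V n))

/-- The change of variables `v_1 ∧ … ∧ v_m ↦ A v_1 ∧ … ∧ A v_m`, for all `m`. -/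
def lambdaCha {n : ℕ} (A : V n →ₗ[ℂ] V n) : ExtFamily n := fun m => exteriorPower.map m A

/-- `IsLambda S T` says that `T` is the operator `λ(S)`, which is defined up to a nonzero factor.
There are two bases of `V`,
`b = (f_1, …, f_p, g_{p+1}, …, g_q, h_{q+1}, …, h_n)` and
`B = (F_1, …, F_p, G_{p+1}, …, G_q, H_{q+1}, …, H_n)`, such that `S` is spanned by the vectors
`0 ⊕ F_i`, `g_i ⊕ G_i`, `h_i ⊕ 0`; and, up to a common nonzero factor `c`, `T` takes
`f_1 ∧ … ∧ f_p ∧ g_{i_1} ∧ … ∧ g_{i_s}` to `F_1 ∧ … ∧ F_p ∧ G_{i_1} ∧ … ∧ G_{i_s}` and all the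
other monomials in the basis `b` to zero. -/
def IsLambda {n : ℕ} (S : Gr n) (T : ExtFamily n) : Prop :=
  ∃ (b B : Module.Basis (Fin n) ℂ (V n)) (p q : ℕ) (c : ℂ), p ≤ q ∧ q ≤ n ∧ c ≠ 0 ∧
    S.1 = Submodule.span ℂ (Set.range fun i : Fin n =>
      ((if (i : ℕ) < p then 0 else b i, if (i : ℕ) < q then B i else 0) : V n × V n)) ∧
    ∀ (m : ℕ) (a : Fin m ↪o Fin n),
      ((∀ i : Fin n, (i : ℕ) < p → i ∈ Set.range a) ∧ (∀ s, (a s : ℕ) < q) →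
        T m (exteriorPower.ιMulti ℂ m fun s => b (a s)) =
          c • exteriorPower.ιMulti ℂ m fun s => B (a s)) ∧
      (¬ ((∀ i : Fin n, (i : ℕ) < p → i ∈ Set.range a) ∧ (∀ s, (a s : ℕ) < q)) →
        T m (exteriorPower.ιMulti ℂ m fun s => b (a s)) = 0)

namespace Hinge

variable {n : ℕ}

/-- `P.IsLift L` says that `L` is the canonically normalized family `𝓛^m(P)`, `m = 0, …, n`:
the factors in the operators `λ(P_j)` are fixed by the requirements that `λ(P_1)` is the change of
variables by the operator with the graph `P_1`, and that `λ(P_j)` and `λ(P_{j+1})` coincide in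
degree `dim Im P_j`, where both are nonzero; `𝓛^m(P)` is then the nonzero operator among the
`λ^m(P_j)`. -/
def IsLift (P : Hinge n) (L : ExtFamily n) : Prop :=
  ∃ T : Fin P.k → ExtFamily n,
    (∀ j, IsLambda (P.P j) (T j)) ∧
    (∀ A : V n →ₗ[ℂ] V n, P.P ⟨0, P.k_pos⟩ = Gr.graph A → T ⟨0, P.k_pos⟩ = lambdaCha A) ∧
    (∀ (j : ℕ) (hj : j + 1 < P.k),
      T ⟨j + 1, hj⟩ (Module.finrank ℂ (P.P ⟨j, Nat.lt_of_succ_lt hj⟩).im) =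
        T ⟨j, Nat.lt_of_succ_lt hj⟩ (Module.finrank ℂ (P.P ⟨j, Nat.lt_of_succ_lt hj⟩).im)) ∧
    ∀ m ≤ n, ∃ j, T j m ≠ 0 ∧ L m = T j m

open Classical in
/-- The canonical family `𝓛(P) = (𝓛^0(P), …, 𝓛^n(P))`. -/
def lift (P : Hinge n) : ExtFamily n := if h : ∃ L, P.IsLift L then h.choose else 0

end Hinge

/-! ## Polynomial representations of `GL_n(ℂ)` -/

section Representations

variable {n : ℕ}

/-- The number `ν_j - ν_{j+1}`, where `ν_{n+1} = 0`. -/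
def mult (ν : Fin n → ℕ) (j : Fin n) : ℕ := ν j - if h : (j : ℕ) + 1 < n then ν ⟨j + 1, h⟩ else 0

/-- The tensor factors of `𝔥_ν`: there are `mult ν j` copies of `Λ^{j+1} V` for each
`j = 0, …, n - 1`. -/
abbrev Factors (ν : Fin n → ℕ) : Type := Σ j : Fin n, Fin (mult ν j)

/-- The space `𝔥_ν = ⨂_j (Λ^j V)^{⊗ (ν_j - ν_{j+1})}`. -/
abbrev BigH (ν : Fin n → ℕ) : Type := ⨂[ℂ] x : Factors ν, ⋀[ℂ]^((x.1 : ℕ) + 1) (V n)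

/-- The operator `𝔯_ν(A) = ⨂_j A_j^{⊗ (ν_j - ν_{j+1})}`. -/
def bigR (ν : Fin n → ℕ) (A : ExtFamily n) : Module.End ℂ (BigH ν) :=
  PiTensorProduct.map fun x : Factors ν => A ((x.1 : ℕ) + 1)

/-- The operators of change of variables for an element of `GL_n(ℂ)`. -/
def glCha (g : GL (Fin n) ℂ) : ExtFamily n := lambdaCha (Matrix.toLin' (g : Matrix _ _ ℂ))

/-- The vector `ξ_{j+1} = e_1 ∧ … ∧ e_{j+1}`. -/
def xi (j : Fin n) : ⋀[ℂ]^((j : ℕ) + 1) (V n) :=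
  exteriorPower.ιMulti ℂ _ fun i : Fin ((j : ℕ) + 1) =>
    (Pi.single (Fin.castLE (Nat.succ_le_of_lt j.isLt) i) 1 : V n)

/-- The vector `Ξ_ν = ⨂_j ξ_j^{⊗ (ν_j - ν_{j+1})}`. -/
def bigXi (ν : Fin n → ℕ) : BigH ν := PiTensorProduct.tprod ℂ fun x : Factors ν => xi x.1

/-- The space `H_ν`: the `GL_n(ℂ)`-cyclic span of `Ξ_ν`. -/
def H (ν : Fin n → ℕ) : Submodule ℂ (BigH ν) :=
  Submodule.span ℂ (Set.range fun g : GL (Fin n) ℂ => bigR ν (glCha g) (bigXi ν))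

instance (ν : Fin n → ℕ) : AddCommGroup (H ν) := Module.addCommMonoidToAddCommGroup ℂ

lemma glCha_one : glCha (1 : GL (Fin n) ℂ) = fun _ => 1 := by
  funext m
  simp only [glCha, lambdaCha, Units.val_one, Matrix.toLin'_one]
  exact exteriorPower.map_id

lemma glCha_mul (g h : GL (Fin n) ℂ) : glCha (g * h) = fun m => glCha g m * glCha h m := by
  funext m
  simp only [glCha, lambdaCha, Units.val_mul, Matrix.toLin'_mul]
  exact exteriorPower.map_comp (Matrix.toLin' (h : Matrix (Fin n) (Fin n) ℂ))
    (Matrix.toLin' (g : Matrix (Fin n) (Fin n) ℂ))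

lemma bigR_one (ν : Fin n → ℕ) : bigR ν (glCha 1) = 1 := by
  rw [glCha_one]
  exact PiTensorProduct.map_one (R := ℂ) (s := fun x : Factors ν => ⋀[ℂ]^((x.1 : ℕ) + 1) (V n))

lemma bigR_mul (ν : Fin n → ℕ) (g h : GL (Fin n) ℂ) :
    bigR ν (glCha (g * h)) = bigR ν (glCha g) * bigR ν (glCha h) := by
  rw [glCha_mul]
  exact PiTensorProduct.map_mul _ _

lemma bigR_mem (ν : Fin n → ℕ) (g : GL (Fin n) ℂ) :
    ∀ x ∈ H ν, bigR ν (glCha g) x ∈ H ν := by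
  intro x hx
  induction hx using Submodule.span_induction with
  | mem x hx =>
    obtain ⟨h, rfl⟩ := hx
    exact Submodule.subset_span ⟨g * h, by simp only [bigR_mul]; rfl⟩
  | zero => simp
  | add x y _ _ hx hy => rw [map_add]; exact add_mem hx hy
  | smul c x _ hx => rw [map_smul]; exact Submodule.smul_mem _ c hx

/-- The irreducible polynomial representation `ρ_ν` of `GL_n(ℂ)` in `H_ν`. -/
def rho (ν : Fin n → ℕ) : Representation ℂ (GL (Fin n) ℂ) (H ν) where
  toFun g := (bigR ν (glCha g)).restrict (bigR_mem ν g)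
  map_one' := by ext x; simp [bigR_one]
  map_mul' g h := by ext x; simp [bigR_mul]

open Classical in
/-- The operator `ρ_ν(A)`, the restriction of `𝔯_ν(A)` to `H_ν`, for a family `A = (A_0, …, A_n)`
such that `H_ν` is invariant under `𝔯_ν(A)`. -/
def rhoExt (ν : Fin n → ℕ) (A : ExtFamily n) : Module.End ℂ (H ν) :=
  if h : ∀ x ∈ H ν, bigR ν A x ∈ H ν then (bigR ν A).restrict h else 0

lemma xi_ne_zero (j : Fin n) : xi j ≠ 0 := by
  intro h
  let D : V n [⋀^Fin ((j : ℕ) + 1)]→ₗ[ℂ] ℂ :=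
    (Matrix.detRowAlternating (n := Fin ((j : ℕ) + 1)) (R := ℂ)).compLinearMap
      (LinearMap.funLeft ℂ ℂ (Fin.castLE (Nat.succ_le_of_lt j.isLt)))
  have h1 : exteriorPower.alternatingMapLinearEquiv D (xi j) = 1 := by
    rw [xi, exteriorPower.alternatingMapLinearEquiv_apply_ιMulti]
    change Matrix.det (Matrix.of fun (i k : Fin ((j : ℕ) + 1)) =>
      (Pi.single (Fin.castLE (Nat.succ_le_of_lt j.isLt) i) (1 : ℂ) : V n)
        (Fin.castLE (Nat.succ_le_of_lt j.isLt) k)) = 1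
    rw [← Matrix.det_one (n := Fin ((j : ℕ) + 1)) (R := ℂ)]
    congr 1
    ext i k
    simp [Matrix.one_apply, Pi.single_apply, eq_comm]
  rw [h, map_zero] at h1
  exact zero_ne_one h1

lemma bigXi_ne_zero (ν : Fin n → ℕ) : bigXi ν ≠ 0 := by
  intro h
  have hf : ∀ x : Factors ν, ∃ f : Module.Dual ℂ (⋀[ℂ]^((x.1 : ℕ) + 1) (V n)),
      f (xi x.1) ≠ 0 := fun x => by
    by_contra! hc
    exact xi_ne_zero x.1 ((Module.forall_dual_apply_eq_zero_iff ℂ _).1 hc)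
  choose f hf using hf
  have h1 : PiTensorProduct.lift
      ((MultilinearMap.mkPiAlgebra ℂ (Factors ν) ℂ).compLinearMap f) (bigXi ν) ≠ 0 := by
    rw [bigXi, PiTensorProduct.lift.tprod]
    simpa [Finset.prod_eq_zero_iff] using fun j s => hf ⟨j, s⟩
  rw [h, map_zero] at h1
  exact h1 rfl

instance (ν : Fin n → ℕ) : Nontrivial (H ν) :=
  ⟨⟨⟨bigXi ν, Submodule.subset_span ⟨1, by simp [bigR_one]⟩⟩, 0, fun h =>
    bigXi_ne_zero ν (congrArg Subtype.val h)⟩⟩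

variable {ι : Type*}

/-- The representation `ζ = ⨁_l ρ_{ν^{(l)}}` of `GL_n(ℂ)` in `Z = ⨁_l H_{ν^{(l)}}`, where `l`
ranges over a finite set. -/
def zeta (ν : ι → Fin n → ℕ) : Representation ℂ (GL (Fin n) ℂ) (∀ l, H (ν l)) where
  toFun g := LinearMap.piMap fun l => rho (ν l) g
  map_one' := by ext1 x; funext l; simp
  map_mul' g h := by ext1 x; funext l; simp

lemma zeta_ne_zero [Nonempty ι] (ν : ι → Fin n → ℕ) (g : GL (Fin n) ℂ) : zeta ν g ≠ 0 := by
  intro h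
  have h1 : (1 : Module.End ℂ (∀ l, H (ν l))) = 0 := by
    rw [← map_one (zeta ν), ← mul_inv_cancel g, map_mul, h, zero_mul]
  obtain ⟨l⟩ := ‹Nonempty ι›
  obtain ⟨x, hx⟩ := exists_ne (0 : H (ν l))
  classical
  have h2 := congrFun (LinearMap.congr_fun h1 (Pi.single l x)) l
  exact hx (by simpa using h2)

/-- The number `v^{(l)} = ∑_j m_j ν_j^{(l)}` for a signature `ν^{(l)}`. -/
def weight (m : Fin n → ℤ) (ν : Fin n → ℕ) : ℤ := ∑ j, m j * (ν j : ℤ)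

/-- The maximal weight `v = max_l v^{(l)}`. -/
def maxWeight [Fintype ι] [Nonempty ι] (m : Fin n → ℤ) (ν : ι → Fin n → ℕ) : ℤ :=
  Finset.univ.sup' Finset.univ_nonempty fun l => weight m (ν l)

/-- The operator `ζ(m, P) = ⨁_l B_l`, where `B_l = ρ_{ν^{(l)}}(𝓛(P))` if `v^{(l)} = v`, and
`B_l = 0` if `v^{(l)} < v`. -/
def zetaHinge [Fintype ι] [Nonempty ι] (ν : ι → Fin n → ℕ) (m : Fin n → ℤ) (P : Hinge n) :
    Module.End ℂ (∀ l, H (ν l)) :=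
  LinearMap.piMap fun l => if weight m (ν l) = maxWeight m ν then rhoExt (ν l) P.lift else 0

end Representations

/-! ## Projective compactifications -/

section Projective

variable (Z : Type*) [AddCommGroup Z] [Module ℂ Z]

/-- The topology of `Mat(Z)`; for a finite-dimensional `Z` this is the usual topology of a
finite-dimensional complex vector space. -/
instance matTopology : TopologicalSpace (Module.End ℂ Z) := moduleTopology ℂ (Module.End ℂ Z)

/-- The projective space `ℙMat(Z)` of nonzero operators up to a nonzero scalar factor. -/
def PMat : Type _ := Projectivization ℂ (Module.End ℂ Z)

variable {Z}

/-- The point of `ℙMat(Z)` defined by a nonzero operator. -/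
def PMat.mk (A : Module.End ℂ Z) (hA : A ≠ 0) : PMat Z := Projectivization.mk ℂ A hA

/-- The quotient topology on `ℙMat(Z) = (Mat(Z) ∖ 0) / ℂ*`. -/
instance : TopologicalSpace (PMat Z) :=
  TopologicalSpace.coinduced (fun A : {A : Module.End ℂ Z // A ≠ 0} => PMat.mk A.1 A.2)
    inferInstance

/-- The image of `g ∈ GL_n(ℂ)` in `ℙMat(Z)` under `ζ`. -/
def zetaPoint {n : ℕ} {ι : Type*} [Nonempty ι] (ν : ι → Fin n → ℕ) (g : GL (Fin n) ℂ) :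
    PMat (∀ l, H (ν l)) := PMat.mk (zeta ν g) (zeta_ne_zero ν g)

/-- The projective compactification `[GL_n]_ζ`: the closure of the image of `GL_n(ℂ)` in
`ℙMat(Z)`. -/
def projCompactification {n : ℕ} {ι : Type*} [Nonempty ι] (ν : ι → Fin n → ℕ) :
    Set (PMat (∀ l, H (ν l))) := closure (Set.range (zetaPoint ν))

end Projective

/-! ## Meromorphic families -/

section Meromorphic

variable {n : ℕ}

/-- A meromorphic family: all the matrix elements are holomorphic in a punctured neighbourhood of
`0` with at most a pole at `0`. (The values of `γ` outside a small punctured disk, in particular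
`γ 0`, play no role.) -/
def IsMeromorphicFamily (γ : ℂ → GL (Fin n) ℂ) : Prop :=
  ∀ i j, MeromorphicAt (fun z => (γ z : Matrix (Fin n) (Fin n) ℂ) i j) 0

/-- `a` represents an element of `GL_n(𝓕)`: a germ at `0` of a holomorphic map to `GL_n(ℂ)`. -/
def IsHolomorphicGerm (a : ℂ → Matrix (Fin n) (Fin n) ℂ) : Prop :=
  (∀ i j, AnalyticAt ℂ (fun z => a z i j) 0) ∧ IsUnit (a 0)

/-- `m_1 ≥ … ≥ m_n` are the exponents of `γ`: `γ(z) = a(z) diag(z^{-m_1}, …, z^{-m_n}) b(z)` near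
`0` with `a, b ∈ GL_n(𝓕)`. -/
def IsExponents (γ : ℂ → GL (Fin n) ℂ) (m : Fin n → ℤ) : Prop :=
  Antitone m ∧ ∃ a b : ℂ → Matrix (Fin n) (Fin n) ℂ,
    IsHolomorphicGerm a ∧ IsHolomorphicGerm b ∧
    ∀ᶠ z in 𝓝[≠] (0 : ℂ),
      (γ z : Matrix (Fin n) (Fin n) ℂ) = a z * Matrix.diagonal (fun i => z ^ (-m i)) * b z

/-- `P = (P_1, …, P_τ)` is the limit hinge of `γ`, where `m` are the exponents of `γ`:
`P_j = lim_{z → 0} z^{k_j} γ(z)` in the Grassmannian, where `k_1 > … > k_τ` are all the pairwise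
different exponents. -/
def IsLimitHinge (γ : ℂ → GL (Fin n) ℂ) (m : Fin n → ℤ) (P : Hinge n) : Prop :=
  ∃ k : Fin P.k → ℤ, StrictAnti k ∧ Set.range k = Set.range m ∧
    ∀ j, Tendsto
      (fun z : ℂ => Gr.graph (Matrix.toLin' (z ^ k j • (γ z : Matrix (Fin n) (Fin n) ℂ))))
      (𝓝[≠] 0) (𝓝 (P.P j))

/-- The normalized exponents: the exponents divided by their greatest common divisor (zeros, if
all the exponents are zero). -/
def normalized (m : Fin n → ℤ) : Fin n → ℤ := fun i => m i / Finset.univ.gcd m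

end Meromorphic

end SeaUrchin

end

noncomputable section

namespace SeaUrchin

/-! ## Weak convergence in vector spaces without a topology -/

/-! Over the germs at 0, `γ` has a Smith form γ = a · diag(z^{-m_i}) · b, found by pivoting on an
entry of least order (`exists_hasFactorization`). Put α = a(0) and β = b(0). The graphs of z^k γ
converge to an explicit relation `limitRel` (`tendsto_limitRel`); for the distinct exponents k these
relations form the limit hinge, which is unique because the Grassmannian is Hausdorff.

On Λ^d the diagonal factor multiplies e_I by z to the power -∑_{i∈I} m_i. For each k, the number ∑
max(m_i - k, 0) + dk bounds all sums ∑_{i∈I} m_i with |I| = d, with equality exactly when I contains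
every i with m_i > k and only i with m_i ≥ k (`admissible_iff`). With this power as normalization
Λ^d γ converges to `limitOp`, which is λ^d of `limitRel`. The limit is nonzero exactly when d lies
in the window `numGT m k ≤ d ≤ numGE m k`, and there the power is S_d, the sum of the d largest
exponents, whatever k is. So z^{S_d} Λ^d γ has a nonzero limit (`WTendsto.lambdaCha`). This
determines S_d, hence the exponents.

That limit is 𝓛^d of the hinge (`lift_limitHinge`). The point is that λ(S) is determined by S up to
a factor, because it intertwines exterior multiplication by the two components of any vector of S
(`IsLambda.exists_smul_eq`), and that the factors are fixed along the hinge in the degrees shared by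
consecutive windows.

Tensoring, ∑ (ν_j - ν_{j+1}) S_j = ∑ m_j ν_j by Abel summation, so z^{v^{(l)}} ρ_ν(γ) tends to
ρ_ν(𝓛). After multiplication by z to the maximal weight, the summands of smaller weight die. A
summand of maximal weight survives, since it sends the translate of the highest vector Ξ by β⁻¹ to
its translate by α (`rhoExt_ne_zero`). A nonzero limit of rescaled operators gives the limit in
projective space. -/

lemma free_of_addCommMonoid (W : Type*) [AddCommMonoid W] [Module ℂ W] : Module.Free ℂ W :=
  letI : AddCommGroup W := Module.addCommMonoidToAddCommGroup ℂ
  inferInstance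

/-- Weak convergence is developed over additive monoids with a ℂ-action, so finiteness is needed in
that generality; scalar multiplication by -1 supplies the group structure locally. -/
lemma finite_submodule {W : Type*} [AddCommMonoid W] [Module ℂ W] [Module.Finite ℂ W]
    (p : Submodule ℂ W) : Module.Finite ℂ p :=
  letI : AddCommGroup W := Module.addCommMonoidToAddCommGroup ℂ
  inferInstance

lemma finite_end (W : Type*) [AddCommMonoid W] [Module ℂ W] [Module.Finite ℂ W] :
    Module.Finite ℂ (Module.End ℂ W) :=
  letI : AddCommGroup W := Module.addCommMonoidToAddCommGroup ℂ
  (inferInstance : Module.Finite ℂ (W →ₗ[ℂ] W))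

/-- Coordinatewise convergence in a complex vector space: convergence after applying an arbitrary
linear functional. -/
def WTendsto {α W : Type*} [AddCommMonoid W] [Module ℂ W] (f : α → W) (l : Filter α) (w : W) :
    Prop :=
  ∀ φ : Module.Dual ℂ W, Tendsto (fun z => φ (f z)) l (𝓝 (φ w))

namespace WTendsto

variable {α : Type*} {l : Filter α}

lemma linear {W W' : Type*} [AddCommMonoid W] [Module ℂ W] [AddCommMonoid W'] [Module ℂ W']
    {f : α → W} {w : W} (h : WTendsto f l w) (L : W →ₗ[ℂ] W') :
    WTendsto (fun z => L (f z)) l (L w) :=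
  fun φ => h (φ ∘ₗ L)

lemma congr' {W : Type*} [AddCommMonoid W] [Module ℂ W] {f g : α → W} {w : W}
    (h : WTendsto f l w) (hfg : f =ᶠ[l] g) : WTendsto g l w := fun φ =>
  (h φ).congr' (hfg.mono fun z hz => by rw [hz])

lemma const {W : Type*} [AddCommMonoid W] [Module ℂ W] (w : W) : WTendsto (fun _ : α => w) l w :=
  fun _ => tendsto_const_nhds

lemma smul {W : Type*} [AddCommMonoid W] [Module ℂ W] {f : α → W} {w : W} {c : α → ℂ} {c₀ : ℂ}
    (hc : Tendsto c l (𝓝 c₀)) (h : WTendsto f l w) :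
    WTendsto (fun z => c z • f z) l (c₀ • w) := fun φ => by
  simpa using hc.mul (h φ)

lemma unique {W : Type*} [AddCommMonoid W] [Module ℂ W] [l.NeBot] {f : α → W} {w w' : W}
    (h : WTendsto f l w) (h' : WTendsto f l w') : w = w' := by
  let : AddCommGroup W := Module.addCommMonoidToAddCommGroup ℂ
  rw [← sub_eq_zero, ← Module.forall_dual_apply_eq_zero_iff ℂ]
  intro φ
  rw [map_sub, sub_eq_zero]
  exact tendsto_nhds_unique (h φ) (h' φ)

/-- In coordinates a multilinear map on finite-dimensional spaces is polynomial, and coordinates are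
linear functionals. -/
lemma multilinear {κ : Type*} [Fintype κ] {E : κ → Type*} {W : Type*}
    [∀ i, AddCommMonoid (E i)] [∀ i, Module ℂ (E i)] [∀ i, Module.Finite ℂ (E i)]
    [AddCommMonoid W] [Module ℂ W] (M : MultilinearMap ℂ E W) {f : ∀ i, α → E i} {w : ∀ i, E i}
    (h : ∀ i, WTendsto (f i) l (w i)) :
    WTendsto (fun z => M fun i => f i z) l (M w) := by
  classical
  intro φ
  have := fun i => free_of_addCommMonoid (E i)
  let b := fun i => Module.finBasis ℂ (E i)
  have key : ∀ v : ∀ i, E i, φ (M v) =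
      ∑ r : ∀ i, Fin (Module.finrank ℂ (E i)),
        (∏ i, (b i).repr (v i) (r i)) * φ (M fun i => b i (r i)) := by
    intro v
    conv_lhs => rw [show v = fun i => ∑ j, (b i).repr (v i) j • b i j from
      funext fun i => ((b i).sum_repr (v i)).symm]
    rw [M.map_sum, map_sum]
    refine Finset.sum_congr rfl fun r _ => ?_
    rw [M.map_smul_univ, map_smul, smul_eq_mul]
  refine Tendsto.congr (fun z => (key _).symm) ?_
  rw [key w]
  refine tendsto_finsetSum _ fun r _ => Tendsto.mul_const _ ?_
  refine tendsto_finsetProd _ fun i _ => ?_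
  exact h i ((b i).coord (r i))

/-- Only the first argument is expanded in a basis, so `F` may be infinite-dimensional. -/
lemma bilinear {E F W : Type*} [AddCommMonoid E] [Module ℂ E] [Module.Finite ℂ E]
    [AddCommMonoid F] [Module ℂ F] [AddCommMonoid W] [Module ℂ W]
    (B : E →ₗ[ℂ] F →ₗ[ℂ] W) {f : α → E} {g : α → F} {v : E} {w : F}
    (hf : WTendsto f l v) (hg : WTendsto g l w) :
    WTendsto (fun z => B (f z) (g z)) l (B v w) := by
  intro φ
  have := free_of_addCommMonoid E
  let b := Module.finBasis ℂ E
  have key : ∀ v w, φ (B v w) = ∑ j, b.repr v j * φ (B (b j) w) := by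
    intro v w
    conv_lhs => rw [← b.sum_repr v]
    rw [map_sum, LinearMap.sum_apply, map_sum]
    simp
  refine Tendsto.congr (fun z => (key _ _).symm) ?_
  rw [key v w]
  refine tendsto_finsetSum _ fun r _ => Tendsto.mul ?_ ?_
  · exact hf (b.coord r)
  · exact hg (φ ∘ₗ B (b r))

/-- Convergence of operators may be checked on a spanning set. -/
lemma of_apply {E W : Type*} [AddCommMonoid E] [Module ℂ E] [Module.Finite ℂ E]
    [AddCommMonoid W] [Module ℂ W] [Module.Finite ℂ W] {f : α → E →ₗ[ℂ] W} {A : E →ₗ[ℂ] W}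
    {s : Set E} (hs : Submodule.span ℂ s = ⊤)
    (h : ∀ x ∈ s, WTendsto (fun z => f z x) l (A x)) : WTendsto f l A := by
  have h' : ∀ x, WTendsto (fun z => f z x) l (A x) := by
    intro x φ
    have hx : x ∈ Submodule.span ℂ s := hs ▸ Submodule.mem_top
    induction hx using Submodule.span_induction with
    | mem x hx => exact h x hx φ
    | zero => simpa using tendsto_const_nhds
    | add x y _ _ hx hy => simpa using hx.add hy
    | smul c x _ hx => simpa using hx.const_mul c
  intro φ
  have := free_of_addCommMonoid E
  let b := Module.finBasis ℂ E
  have := free_of_addCommMonoid W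
  let c := Module.finBasis ℂ W
  have key : ∀ B : E →ₗ[ℂ] W, φ B = ∑ i, ∑ j, c.repr (B (b i)) j *
      φ ((b.coord i).smulRight (c j)) := by
    intro B
    have hB : B = ∑ i, ∑ j, c.repr (B (b i)) j • (b.coord i).smulRight (c j) := by
      refine b.ext fun i' => ?_
      simp only [LinearMap.sum_apply, LinearMap.smul_apply, LinearMap.smulRight_apply,
        Module.Basis.coord_apply, Module.Basis.repr_self]
      rw [Finset.sum_eq_single i']
      · simp [c.sum_repr]
      · intro i _ hi
        simp [Finsupp.single_eq_of_ne hi]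
      · simp
    conv_lhs => rw [hB]
    simp [map_sum]
  refine Tendsto.congr (fun z => (key _).symm) ?_
  rw [key A]
  refine tendsto_finsetSum _ fun i _ => tendsto_finsetSum _ fun j _ => Tendsto.mul_const _ ?_
  exact h' (b i) (c.coord j)

lemma apply {E W : Type*} [AddCommMonoid E] [Module ℂ E]
    [AddCommMonoid W] [Module ℂ W] {f : α → E →ₗ[ℂ] W} {A : E →ₗ[ℂ] W}
    (h : WTendsto f l A) (x : E) : WTendsto (fun z => f z x) l (A x) :=
  h.linear (LinearMap.applyₗ x)

lemma mul {E : Type*} [AddCommMonoid E] [Module ℂ E] [Module.Finite ℂ E]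
    {f g : α → Module.End ℂ E} {A B : Module.End ℂ E}
    (hf : WTendsto f l A) (hg : WTendsto g l B) : WTendsto (fun z => f z * g z) l (A * B) :=
  have := finite_end E
  bilinear (LinearMap.mul ℂ (Module.End ℂ E)) hf hg

lemma of_tendsto {W : Type*} [AddCommMonoid W] [Module ℂ W] [TopologicalSpace W]
    [IsModuleTopology ℂ W] {f : α → W} {w : W} (h : Tendsto f l (𝓝 w)) : WTendsto f l w :=
  fun φ => ((IsModuleTopology.continuous_of_linearMap φ).tendsto w).comp h

lemma tendsto {W : Type*} [AddCommMonoid W] [Module ℂ W] [Module.Finite ℂ W]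
    [TopologicalSpace W] [IsModuleTopology ℂ W] {f : α → W} {w : W} (h : WTendsto f l w) :
    Tendsto f l (𝓝 w) := by
  have := IsModuleTopology.toContinuousAdd ℂ W
  have := free_of_addCommMonoid W
  let b := Module.finBasis ℂ W
  have key : ∀ v, v = ∑ j, b.repr v j • b j := fun v => (b.sum_repr v).symm
  rw [key w]
  refine Tendsto.congr (fun z => (key (f z)).symm) ?_
  refine tendsto_finsetSum _ fun j _ => Tendsto.smul ?_ tendsto_const_nhds
  exact h (b.coord j)

/-- The limit of vectors of a subspace belongs to this subspace. -/
lemma mem {W : Type*} [AddCommMonoid W] [Module ℂ W] [l.NeBot] {f : α → W} {w : W}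
    (h : WTendsto f l w) (p : Submodule ℂ W) (hf : ∀ᶠ z in l, f z ∈ p) : w ∈ p := by
  let : AddCommGroup W := Module.addCommMonoidToAddCommGroup ℂ
  by_contra hw
  obtain ⟨φ, hφ, hp⟩ := Submodule.exists_le_ker_of_notMem hw
  refine hφ (tendsto_nhds_unique (h φ) ?_)
  refine tendsto_const_nhds.congr' (hf.mono fun z hz => ?_)
  exact (hp hz : φ (f z) = 0).symm

/-- A family with two nonzero limits under different normalizations by powers of the parameter. -/
lemma zpow_unique {W : Type*} [AddCommMonoid W] [Module ℂ W] {f : ℂ → W} {w w' : W} {s s' : ℤ}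
    (h : WTendsto (fun z => z ^ s • f z) (𝓝[≠] 0) w)
    (h' : WTendsto (fun z => z ^ s' • f z) (𝓝[≠] 0) w') (hw : w ≠ 0) (hw' : w' ≠ 0) : s = s' := by
  wlog hss : s < s' generalizing s s' w w'
  · rcases lt_trichotomy s s' with hlt | heq | hgt
    · exact this h h' hw hw' hlt
    · exact heq
    · exact (this h' h hw' hw hgt).symm
  exfalso
  apply hw'
  -- The second normalization is the first one times a positive power of z, which forces its limit
  -- to be 0.
  have hz : Tendsto (fun z : ℂ => z ^ (s' - s)) (𝓝[≠] 0) (𝓝 0) := by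
    obtain ⟨k, hk⟩ := Int.eq_ofNat_of_zero_le (sub_pos.2 hss).le
    have hk0 : k ≠ 0 := by omega
    simp only [hk, zpow_natCast]
    have : Tendsto (fun z : ℂ => z ^ k) (𝓝 0) (𝓝 (0 ^ k)) := (continuous_pow k).tendsto 0
    rw [zero_pow hk0] at this
    exact this.mono_left nhdsWithin_le_nhds
  have h2 := smul hz h
  rw [zero_smul] at h2
  refine h'.unique (h2.congr' ?_)
  filter_upwards [self_mem_nhdsWithin] with z hz0
  rw [smul_smul, ← zpow_add₀ hz0]
  congr 2
  ring

end WTendsto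

section

/-! ## The topology of the Grassmannian -/

variable {n : ℕ}

lemma Gr.isOpen_iff (O : Set (Gr n)) : IsOpen O ↔ IsOpen (Frame.span ⁻¹' O) := Iff.rfl

lemma Gr.isOpen_meets (w : V n × V n) (ε : ℝ) :
    IsOpen {S : Gr n | ∃ s ∈ S.1, dist s w < ε} := by
  rw [Gr.isOpen_iff]
  have : Frame.span ⁻¹' {S : Gr n | ∃ s ∈ S.1, dist s w < ε} =
      ⋃ c : Fin n → ℂ, {u : Frame n | dist (∑ i, c i • u.1 i) w < ε} := by
    ext u
    simp only [Set.mem_preimage, Set.mem_ofPred_eq, Set.mem_iUnion, Frame.span]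
    constructor
    · rintro ⟨s, hs, h⟩
      obtain ⟨c, rfl⟩ := (Submodule.mem_span_range_iff_exists_fun ℂ).1 hs
      exact ⟨c, h⟩
    · rintro ⟨c, h⟩
      exact ⟨_, (Submodule.mem_span_range_iff_exists_fun ℂ).2 ⟨c, rfl⟩, h⟩
  rw [this]
  refine isOpen_iUnion fun c => isOpen_lt (Continuous.dist ?_ continuous_const) continuous_const
  exact continuous_finsetSum _ fun i _ =>
    ((continuous_apply i).comp continuous_subtype_val).const_smul (c i)

/-- A vector lies off the span of a frame exactly when adjoining it keeps the tuple independent,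
which is an open condition on the pair; compactness of `K` makes the neighbourhood of the frame
uniform in the vector. -/
lemma Gr.isOpen_misses {K : Set (V n × V n)} (hK : IsCompact K) :
    IsOpen {S : Gr n | ∀ s ∈ K, s ∉ S.1} := by
  rw [Gr.isOpen_iff, isOpen_iff_eventually]
  intro u hu
  refine hK.eventually_forall_of_forall_eventually
    (P := fun (v : Frame n) s => s ∉ v.span.1) fun y hy => ?_
  have hopen : IsOpen {v : Fin (n + 1) → V n × V n | LinearIndependent ℂ v} :=
    isOpen_setOfPred_linearIndependent
  have hcont : Continuous fun p : Frame n × (V n × V n) =>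
      (Fin.cons p.2 p.1.1 : Fin (n + 1) → V n × V n) := by
    refine continuous_pi fun i => ?_
    refine Fin.cases ?_ (fun i => ?_) i
    · exact continuous_snd
    · exact (continuous_apply i).comp (continuous_subtype_val.comp continuous_fst)
  have hmem : LinearIndependent ℂ (Fin.cons y u.1 : Fin (n + 1) → V n × V n) :=
    linearIndependent_finCons.2 ⟨u.2, hu y hy⟩
  filter_upwards [(hopen.preimage hcont).mem_nhds (show _ from hmem)] with p hp
  exact (linearIndependent_finCons.1 hp).2

/-- Equal dimensions give a vector w of Q outside P. A small closed ball around w misses P;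
subspaces missing this ball and subspaces meeting its interior form disjoint open sets. -/
instance : T2Space (Gr n) := by
  refine ⟨fun P Q hPQ => ?_⟩
  have hnot : ¬ Q.1 ≤ P.1 := fun hle =>
    hPQ (Subtype.ext (Submodule.eq_of_le_of_finrank_eq hle (Q.2.trans P.2.symm)).symm)
  obtain ⟨w, hwQ, hwP⟩ := SetLike.not_le_iff_exists.1 hnot
  have hcl : IsClosed (P.1 : Set (V n × V n)) := P.1.closed_of_finiteDimensional
  obtain ⟨ε, hε, hball⟩ := Metric.nhds_basis_closedBall.mem_iff.1
    (hcl.isOpen_compl.mem_nhds (show w ∈ (P.1 : Set (V n × V n))ᶜ from hwP))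
  refine ⟨_, _, Gr.isOpen_misses (isCompact_closedBall w ε), Gr.isOpen_meets w ε,
    fun s hs hsP => hball hs hsP, ⟨w, hwQ, by simpa using hε⟩, ?_⟩
  rw [Set.disjoint_left]
  rintro S h1 ⟨s, hs, hd⟩
  exact h1 s (Metric.mem_closedBall.2 hd.le) hs

/-- Subspaces spanned by convergent families of vectors with linearly independent limits. -/
lemma Gr.tendsto_of_span {α : Type*} {l : Filter α} {S : α → Gr n} {u : α → Fin n → V n × V n}
    (u₀ : Frame n) (hu : Tendsto u l (𝓝 u₀.1))
    (hS : ∀ᶠ z in l, (S z).1 = Submodule.span ℂ (Set.range (u z))) :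
    Tendsto S l (𝓝 u₀.span) := by
  rw [tendsto_nhds]
  intro O hO hmem
  obtain ⟨O', hO', hpre⟩ := isOpen_induced_iff.1 ((Gr.isOpen_iff O).1 hO)
  have h0 : u₀.1 ∈ O' := by
    have : u₀ ∈ Subtype.val ⁻¹' O' := hpre ▸ hmem
    exact this
  filter_upwards [hu (hO'.mem_nhds h0), hS] with z hz hSz
  -- An n-dimensional space spanned by n vectors has them as a basis, so the tuple is a frame.
  have hli : LinearIndependent ℂ (u z) := by
    rw [linearIndependent_iff_card_eq_finrank_span, Set.finrank, ← hSz, (S z).2, Fintype.card_fin]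
  have hin : (⟨u z, hli⟩ : Frame n) ∈ Frame.span ⁻¹' O := hpre ▸ hz
  have heq : S z = Frame.span ⟨u z, hli⟩ := Subtype.ext hSz
  show S z ∈ O
  rw [heq]
  exact hin

end

section

/-! ## Exterior multiplication -/

variable {n : ℕ}

/-- Left exterior multiplication by a vector. -/
def wedge (m : ℕ) : V n →ₗ[ℂ] ⋀[ℂ]^m (V n) →ₗ[ℂ] ⋀[ℂ]^(m + 1) (V n) :=
  LinearMap.mk₂ ℂ
    (fun x ω => ⟨ExteriorAlgebra.ι ℂ x * ω.1, by
      have := Submodule.mul_mem_mul (LinearMap.mem_range_self (ExteriorAlgebra.ι ℂ) x) ω.2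
      rwa [← pow_succ'] at this⟩)
    (fun x y ω => Subtype.ext (by simp [add_mul]))
    (fun c x ω => Subtype.ext (by simp))
    (fun x ω η => Subtype.ext (by simp [mul_add]))
    (fun c x ω => Subtype.ext (by simp))

lemma wedge_ιMulti (m : ℕ) (x : V n) (v : Fin m → V n) :
    wedge m x (exteriorPower.ιMulti ℂ m v) =
      exteriorPower.ιMulti ℂ (m + 1) (Fin.cons x v : Fin (m + 1) → V n) := by
  apply Subtype.ext
  rw [exteriorPower.ιMulti_apply_coe, ExteriorAlgebra.ιMulti_succ_apply]
  rfl

lemma ιMulti_basis_ne_zero {ι : Type*} (B : Module.Basis ι ℂ (V n)) {m : ℕ} {a : Fin m → ι}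
    (ha : Function.Injective a) : exteriorPower.ιMulti ℂ m (fun s => B (a s)) ≠ 0 := by
  have hli : LinearIndependent ℂ fun s => B (a s) := B.linearIndependent.comp a ha
  have h := exteriorPower.ιMulti_family_linearIndependent_field (n := m) hli
  -- The full subset of `Fin m` has the identity as its increasing enumeration, so it selects the
  -- required monomial.
  have h2 := h.ne_zero ⟨Finset.univ, by simp⟩
  have h3 : (exteriorPower.ιMulti_family ℂ m (fun s => B (a s)))
      ⟨Finset.univ, by simp⟩ = exteriorPower.ιMulti ℂ m (fun s => B (a s)) := by
    rw [exteriorPower.ιMulti_family]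
    congr 1
    funext s
    have : (Set.powersetCard.ofFinEmbEquiv.symm ⟨(Finset.univ : Finset (Fin m)), by simp⟩) s = s := by
      rw [Set.powersetCard.ofFinEmbEquiv_symm_apply]
      have := Finset.orderEmbOfFin_unique (s := (Finset.univ : Finset (Fin m))) (k := m) (by simp)
        (f := id) (by simp) strictMono_id
      exact (congrFun this s).symm
    simp [this]
  rwa [h3] at h2

lemma exteriorPower_hom_ext {ι : Type*} [LinearOrder ι] (b : Module.Basis ι ℂ (V n)) {m : ℕ}
    {W : Type*} [AddCommMonoid W] [Module ℂ W] {f g : ⋀[ℂ]^m (V n) →ₗ[ℂ] W}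
    (h : ∀ a : Fin m ↪o ι, f (exteriorPower.ιMulti ℂ m fun s => b (a s)) =
      g (exteriorPower.ιMulti ℂ m fun s => b (a s))) : f = g := by
  refine (b.exteriorPower m).ext fun s => ?_
  rw [exteriorPower.basis_apply]
  exact h _

/-- The range of a tuple of indices contains all the indices below `p` and consists of indices
below `q`. -/
def Admissible {m : ℕ} (p q : ℕ) (a : Fin m → Fin n) : Prop :=
  (∀ i : Fin n, (i : ℕ) < p → i ∈ Set.range a) ∧ ∀ s, (a s : ℕ) < q

lemma Admissible.le {m p q : ℕ} (hp : p ≤ n) {a : Fin m → Fin n} (h : Admissible p q a) :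
    p ≤ m := by
  choose f hf using fun i : Fin p => h.1 (Fin.castLE hp i) i.2
  have hinj : Function.Injective f := fun i j hij => by
    have : Fin.castLE hp i = Fin.castLE hp j := by rw [← hf, ← hf, hij]
    exact Fin.castLE_injective hp this
  simpa using Fintype.card_le_of_injective f hinj

lemma admissible_castLE {p q m : ℕ} (hpm : p ≤ m) (hmq : m ≤ q) (hm : m ≤ n) :
    Admissible p q (Fin.castLE hm) :=
  ⟨fun i hi => ⟨⟨i, hi.trans_le hpm⟩, rfl⟩, fun s => s.2.trans_le hmq⟩

lemma admissible_comp_perm {m p q : ℕ} (a : Fin m → Fin n) (σ : Equiv.Perm (Fin m)) :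
    Admissible p q (a ∘ σ) ↔ Admissible p q a := by
  unfold Admissible
  rw [σ.surjective.range_comp]
  refine and_congr_right fun _ => ⟨fun h s => ?_, fun h s => h _⟩
  simpa using h (σ.symm s)

lemma admissible_cons {m p q : ℕ} (i : Fin n) (hi : p ≤ i) (a : Fin m → Fin n) :
    Admissible p q (Fin.cons i a : Fin (m + 1) → Fin n) ↔ (i : ℕ) < q ∧ Admissible p q a := by
  unfold Admissible
  rw [Fin.range_cons, Fin.forall_fin_succ]
  simp only [Fin.cons_zero, Fin.cons_succ]
  constructor
  · rintro ⟨h1, h2, h3⟩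
    refine ⟨h2, fun j hj => ?_, h3⟩
    rcases h1 j hj with rfl | h
    · omega
    · exact h
  · rintro ⟨h2, h1, h3⟩
    exact ⟨fun j hj => Set.mem_insert_of_mem _ (h1 j hj), h2, h3⟩

open Classical in
/-- The image of a monomial under the operator determined by a basis. -/
def monomialImage (B : Module.Basis (Fin n) ℂ (V n)) (p q : ℕ) (c : ℂ) {m : ℕ}
    (a : Fin m → Fin n) : ⋀[ℂ]^m (V n) :=
  if Admissible p q a then c • exteriorPower.ιMulti ℂ m fun s => B (a s) else 0

section monomialImage

variable (B : Module.Basis (Fin n) ℂ (V n)) (p q : ℕ) (c : ℂ) {m : ℕ}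

lemma ιMulti_comp_perm (a : Fin m → Fin n) (σ : Equiv.Perm (Fin m)) :
    exteriorPower.ιMulti ℂ m (fun s => B ((a ∘ σ) s)) =
      Equiv.Perm.sign σ • exteriorPower.ιMulti ℂ m fun s => B (a s) :=
  (exteriorPower.ιMulti ℂ m).map_perm (fun s => B (a s)) σ

lemma ιMulti_not_injective {a : Fin m → Fin n} (ha : ¬ Function.Injective a) :
    exteriorPower.ιMulti ℂ m (fun s => B (a s)) = 0 :=
  (exteriorPower.ιMulti ℂ m).map_eq_zero_of_not_injective _
    fun h => ha (Function.Injective.of_comp (f := B) h)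

lemma monomialImage_comp_perm (a : Fin m → Fin n) (σ : Equiv.Perm (Fin m)) :
    monomialImage B p q c (a ∘ σ) = Equiv.Perm.sign σ • monomialImage B p q c a := by
  unfold monomialImage
  rw [admissible_comp_perm, ιMulti_comp_perm]
  split_ifs
  · exact smul_comm _ _ _
  · simp

lemma monomialImage_not_injective {a : Fin m → Fin n} (ha : ¬ Function.Injective a) :
    monomialImage B p q c a = 0 := by
  unfold monomialImage
  rw [ιMulti_not_injective B ha]
  simp

/-- The intertwining relation on monomials. For i < p the vector B_i already occurs in every
admissible image, so its wedge vanishes, in agreement with the zero first component of `relVec`. -/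
lemma wedge_monomialImage (hpq : p ≤ q) (i : Fin n) (a : Fin m → Fin n) :
    wedge m (if (i : ℕ) < q then B i else 0) (monomialImage B p q c a) =
      if (i : ℕ) < p then 0 else
        monomialImage B p q c (Fin.cons i a : Fin (m + 1) → Fin n) := by
  have hcons : (fun s => B ((Fin.cons i a : Fin (m + 1) → Fin n) s)) =
      (Fin.cons (B i) fun s => B (a s) : Fin (m + 1) → V n) := by
    funext s
    refine Fin.cases ?_ (fun s => ?_) s <;> simp
  by_cases hip : (i : ℕ) < p
  · rw [if_pos hip, if_pos (hip.trans_le hpq), monomialImage]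
    split_ifs with ha
    · obtain ⟨s, hs⟩ := ha.1 i hip
      rw [map_smul, wedge_ιMulti, ← hcons, ιMulti_not_injective, smul_zero]
      intro hinj
      have : (0 : Fin (m + 1)) = s.succ := hinj (by simp [hs])
      exact absurd this (Fin.succ_ne_zero s).symm
    · simp
  · rw [if_neg hip]
    unfold monomialImage
    rw [admissible_cons i (not_lt.1 hip)]
    by_cases hiq : (i : ℕ) < q
    · by_cases ha : Admissible p q a
      · rw [if_pos hiq, if_pos ha, if_pos ⟨hiq, ha⟩, map_smul, wedge_ιMulti, hcons]
      · rw [if_neg ha, if_neg (fun h : _ ∧ _ => ha h.2), map_zero]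
    · rw [if_neg hiq, if_neg (fun h : _ ∧ _ => hiq h.1), map_zero, LinearMap.zero_apply]

end monomialImage

/-! ## The operators `λ(S)` -/

/-- The vectors `0 ⊕ F_i`, `g_i ⊕ G_i`, `h_i ⊕ 0`. -/
def relVec (b B : Module.Basis (Fin n) ℂ (V n)) (p q : ℕ) (i : Fin n) : V n × V n :=
  (if (i : ℕ) < p then 0 else b i, if (i : ℕ) < q then B i else 0)

/-- All the operators of the family are given by the standard formula in the bases `b`, `B`. -/
def ActsBy (b B : Module.Basis (Fin n) ℂ (V n)) (p q : ℕ) (c : ℂ) (T : ExtFamily n) : Prop :=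
  ∀ (m : ℕ) (a : Fin m → Fin n),
    T m (exteriorPower.ιMulti ℂ m fun s => b (a s)) = monomialImage B p q c a

/-- Both sides change by the sign under permutations and vanish on repeated indices, so increasing
tuples suffice. -/
lemma actsBy_of_orderEmb {b B : Module.Basis (Fin n) ℂ (V n)} {p q : ℕ} {c : ℂ} {T : ExtFamily n}
    (h : ∀ (m : ℕ) (a : Fin m ↪o Fin n),
      T m (exteriorPower.ιMulti ℂ m fun s => b (a s)) = monomialImage B p q c a) :
    ActsBy b B p q c T := by
  intro m a
  by_cases ha : Function.Injective a
  · have hmono : StrictMono (a ∘ Tuple.sort a) :=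
      (Tuple.monotone_sort a).strictMono_of_injective (ha.comp (Tuple.sort a).injective)
    have h1 := h m (OrderEmbedding.ofStrictMono _ hmono)
    simp only [OrderEmbedding.coe_ofStrictMono] at h1
    rw [ιMulti_comp_perm, monomialImage_comp_perm, Units.smul_def, map_zsmul, ← Units.smul_def] at h1
    exact smul_left_cancel _ h1
  · rw [ιMulti_not_injective b ha, monomialImage_not_injective B p q c ha, map_zero]

lemma isLambda_iff {S : Gr n} {T : ExtFamily n} :
    IsLambda S T ↔ ∃ (b B : Module.Basis (Fin n) ℂ (V n)) (p q : ℕ) (c : ℂ), p ≤ q ∧ q ≤ n ∧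
      c ≠ 0 ∧ S.1 = Submodule.span ℂ (Set.range (relVec b B p q)) ∧ ActsBy b B p q c T := by
  constructor
  · rintro ⟨b, B, p, q, c, hpq, hq, hc, hS, hT⟩
    refine ⟨b, B, p, q, c, hpq, hq, hc, hS, actsBy_of_orderEmb fun m a => ?_⟩
    unfold monomialImage
    split_ifs with ha
    · exact (hT m a).1 ha
    · exact (hT m a).2 ha
  · rintro ⟨b, B, p, q, c, hpq, hq, hc, hS, hT⟩
    refine ⟨b, B, p, q, c, hpq, hq, hc, hS, fun m a => ⟨fun ha => ?_, fun ha => ?_⟩⟩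
    · rw [hT m a, monomialImage, if_pos (show Admissible p q a from ha)]
    · rw [hT m a, monomialImage, if_neg (show ¬ Admissible p q a from ha)]

section Span

variable {S : Gr n} {b B : Module.Basis (Fin n) ℂ (V n)} {p q : ℕ}

lemma indef_eq_span (hS : S.1 = Submodule.span ℂ (Set.range (relVec b B p q))) (hpq : p ≤ q)
    (hp : p ≤ n) : S.indef = Submodule.span ℂ (Set.range fun i => B (Fin.castLE hp i)) := by
  apply le_antisymm
  · intro y hy
    have hy : ((0 : V n), y) ∈ S.1 := hy
    rw [hS, Submodule.mem_span_range_iff_exists_fun] at hy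
    obtain ⟨c, hc⟩ := hy
    have h1 : ∑ i : Fin n, (if (i : ℕ) < p then 0 else c i) • b i = 0 := by
      rw [← show _ = (0 : V n) from congrArg Prod.fst hc, Prod.fst_sum]
      refine Finset.sum_congr rfl fun i _ => ?_
      simp only [relVec, Prod.smul_fst]
      split_ifs <;> simp
    have h0 := Fintype.linearIndependent_iff.1 b.linearIndependent _ h1
    rw [← show _ = y from congrArg Prod.snd hc, Prod.snd_sum]
    refine Submodule.sum_mem _ fun i _ => ?_
    simp only [relVec, Prod.smul_snd]
    by_cases hi : (i : ℕ) < p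
    · rw [if_pos (hi.trans_le hpq)]
      exact Submodule.smul_mem _ _ (Submodule.subset_span ⟨⟨i, hi⟩, rfl⟩)
    · have := h0 i
      rw [if_neg hi] at this
      simp [this]
  · rw [Submodule.span_le]
    rintro _ ⟨i, rfl⟩
    show ((0 : V n), B (Fin.castLE hp i)) ∈ S.1
    rw [hS]
    refine Submodule.subset_span ⟨Fin.castLE hp i, ?_⟩
    simp [relVec, i.2.trans_le hpq]

lemma finrank_span_castLE (B : Module.Basis (Fin n) ℂ (V n)) (hp : p ≤ n) :
    Module.finrank ℂ (Submodule.span ℂ (Set.range fun i => B (Fin.castLE hp i))) = p := by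
  have := finrank_span_eq_card (B.linearIndependent.comp _ (Fin.castLE_injective hp))
  rwa [Fintype.card_fin] at this

lemma finrank_indef (hS : S.1 = Submodule.span ℂ (Set.range (relVec b B p q))) (hpq : p ≤ q)
    (hq : q ≤ n) : Module.finrank ℂ S.indef = p := by
  rw [indef_eq_span hS hpq (hpq.trans hq), finrank_span_castLE]

lemma im_eq_span (hS : S.1 = Submodule.span ℂ (Set.range (relVec b B p q))) (hq : q ≤ n) :
    S.im = Submodule.span ℂ (Set.range fun i => B (Fin.castLE hq i)) := by
  rw [Gr.im, hS, Submodule.map_span, ← Set.range_comp]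
  apply le_antisymm
  · rw [Submodule.span_le]
    rintro _ ⟨i, rfl⟩
    simp only [Function.comp_apply, relVec, LinearMap.snd_apply, SetLike.mem_coe]
    split_ifs with hi
    · exact Submodule.subset_span ⟨⟨i, hi⟩, rfl⟩
    · exact zero_mem _
  · rw [Submodule.span_le]
    rintro _ ⟨i, rfl⟩
    refine Submodule.subset_span ⟨Fin.castLE hq i, ?_⟩
    simp [relVec]

lemma finrank_im (hS : S.1 = Submodule.span ℂ (Set.range (relVec b B p q))) (hq : q ≤ n) :
    Module.finrank ℂ S.im = q := by
  rw [im_eq_span hS hq, finrank_span_castLE]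

end Span

/-- This relation refers to the span only and not to the bases chosen in it, which is what makes
λ(S) independent of the bases. -/
lemma ActsBy.wedge_comm {b B : Module.Basis (Fin n) ℂ (V n)} {p q : ℕ} {c : ℂ}
    {T : ExtFamily n} (hT : ActsBy b B p q c T) (hpq : p ≤ q) {x : V n × V n}
    (hx : x ∈ Submodule.span ℂ (Set.range (relVec b B p q))) (m : ℕ) :
    T (m + 1) ∘ₗ wedge m x.1 = wedge m x.2 ∘ₗ T m := by
  induction hx using Submodule.span_induction with
  | mem x hx =>
    obtain ⟨i, rfl⟩ := hx
    refine exteriorPower_hom_ext b fun a => ?_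
    rw [LinearMap.comp_apply, LinearMap.comp_apply, hT m a]
    have := wedge_monomialImage B p q c hpq i a
    simp only [relVec]
    rw [this]
    split_ifs with hi
    · simp
    · rw [wedge_ιMulti, ← hT]
      congr 2
      funext s
      refine Fin.cases ?_ (fun s => ?_) s <;> simp
  | zero => simp
  | add x y _ _ hx hy =>
    simp only [Prod.fst_add, Prod.snd_add, map_add, LinearMap.comp_add, LinearMap.add_comp, hx, hy]
  | smul t x _ hx =>
    simp only [Prod.smul_fst, Prod.smul_snd, map_smul, LinearMap.comp_smul, LinearMap.smul_comp, hx]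

lemma ActsBy.eq_zero_of_lt {b B : Module.Basis (Fin n) ℂ (V n)} {p q : ℕ} {c : ℂ}
    {T : ExtFamily n} (hT : ActsBy b B p q c T) (hp : p ≤ n) {m : ℕ} (hm : m < p) : T m = 0 := by
  refine exteriorPower_hom_ext b fun a => ?_
  rw [hT, monomialImage, if_neg fun h => absurd (h.le hp) (not_le.2 hm), LinearMap.zero_apply]

/-- The top exterior power of the p-dimensional span of `v` is a line. -/
lemma mem_span_ιMulti_of_mem_span {p : ℕ} {v w : Fin p → V n} (hv : LinearIndependent ℂ v)
    (hne : exteriorPower.ιMulti ℂ p v ≠ 0)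
    (hw : ∀ i, w i ∈ Submodule.span ℂ (Set.range v)) :
    exteriorPower.ιMulti ℂ p w ∈ Submodule.span ℂ {exteriorPower.ιMulti ℂ p v} := by
  set W := Submodule.span ℂ (Set.range v)
  let v' : Fin p → W := fun i => ⟨v i, Submodule.subset_span ⟨i, rfl⟩⟩
  let w' : Fin p → W := fun i => ⟨w i, hw i⟩
  have h1 : exteriorPower.map p W.subtype (exteriorPower.ιMulti ℂ p v') =
      exteriorPower.ιMulti ℂ p v := exteriorPower.map_apply_ιMulti _ _
  have h2 : exteriorPower.map p W.subtype (exteriorPower.ιMulti ℂ p w') =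
      exteriorPower.ιMulti ℂ p w := exteriorPower.map_apply_ιMulti _ _
  have hfr : Module.finrank ℂ (⋀[ℂ]^p W) = 1 := by
    rw [exteriorPower.finrank_eq, finrank_span_eq_card hv]
    simp
  have hne' : exteriorPower.ιMulti ℂ p v' ≠ 0 := fun h => hne (by rw [← h1, h, map_zero])
  obtain ⟨c, hc⟩ := (finrank_eq_one_iff_of_nonzero' _ hne').1 hfr (exteriorPower.ιMulti ℂ p w')
  rw [← h2, ← hc, map_smul, h1]
  exact Submodule.smul_mem _ _ (Submodule.mem_span_singleton_self _)

/-- An admissible tuple of length p is a permutation of the first p indices, so in degree p the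
range lies in a single line, the top exterior power of the indeterminacy. -/
lemma ActsBy.apply_mem_span {b B : Module.Basis (Fin n) ℂ (V n)} {p q : ℕ} {c : ℂ}
    {T : ExtFamily n} (hT : ActsBy b B p q c T) (hp : p ≤ n) (ω : ⋀[ℂ]^p (V n)) :
    T p ω ∈ Submodule.span ℂ {exteriorPower.ιMulti ℂ p fun i => B (Fin.castLE hp i)} := by
  have hle : LinearMap.range (T p) ≤
      Submodule.span ℂ {exteriorPower.ιMulti ℂ p fun i => B (Fin.castLE hp i)} := by
    rw [LinearMap.range_eq_map, ← (b.exteriorPower p).span_eq, Submodule.map_span,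
      Submodule.span_le]
    rintro _ ⟨_, ⟨s, rfl⟩, rfl⟩
    rw [exteriorPower.basis_apply]
    have h := hT p (Set.powersetCard.ofFinEmbEquiv.symm s)
    rw [SetLike.mem_coe]
    refine (congrArg (· ∈ _) h).mpr ?_
    unfold monomialImage
    split_ifs with ha
    · refine Submodule.smul_mem _ _ (mem_span_ιMulti_of_mem_span
        (B.linearIndependent.comp _ (Fin.castLE_injective hp))
        (ιMulti_basis_ne_zero B (Fin.castLE_injective hp)) fun s' => ?_)
      set a := Set.powersetCard.ofFinEmbEquiv.symm s
      choose f hf using fun i : Fin p => ha.1 (Fin.castLE hp i) i.2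
      have hinj : Function.Injective f := fun i j hij => by
        have : Fin.castLE hp i = Fin.castLE hp j := by rw [← hf, ← hf, hij]
        exact Fin.castLE_injective hp this
      obtain ⟨i, rfl⟩ := (Finite.injective_iff_surjective.1 hinj) s'
      rw [hf]
      exact Submodule.subset_span ⟨i, rfl⟩
    · exact zero_mem _
  exact hle ⟨ω, rfl⟩

lemma ActsBy.apply_castLE {b B : Module.Basis (Fin n) ℂ (V n)} {p q : ℕ} {c : ℂ}
    {T : ExtFamily n} (hT : ActsBy b B p q c T) {m : ℕ} (hpm : p ≤ m) (hmq : m ≤ q) (hm : m ≤ n) :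
    T m (exteriorPower.ιMulti ℂ m fun i => b (Fin.castLE hm i)) =
      c • exteriorPower.ιMulti ℂ m fun i => B (Fin.castLE hm i) := by
  rw [hT, monomialImage, if_pos (admissible_castLE hpm hmq hm)]

lemma ActsBy.ne_zero {b B : Module.Basis (Fin n) ℂ (V n)} {p q : ℕ} {c : ℂ}
    {T : ExtFamily n} (hT : ActsBy b B p q c T) (hc : c ≠ 0) {m : ℕ} (hpm : p ≤ m) (hmq : m ≤ q)
    (hq : q ≤ n) : T m ≠ 0 := by
  intro h
  have h1 := hT.apply_castLE hpm hmq (hmq.trans hq)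
  rw [h, LinearMap.zero_apply] at h1
  exact smul_ne_zero hc (ιMulti_basis_ne_zero B (Fin.castLE_injective _)) h1.symm

lemma ActsBy.eq_zero_of_gt {b B : Module.Basis (Fin n) ℂ (V n)} {p q : ℕ} {c : ℂ}
    {T : ExtFamily n} (hT : ActsBy b B p q c T) {m : ℕ} (hm : q < m) : T m = 0 := by
  refine exteriorPower_hom_ext b fun a => ?_
  rw [hT, monomialImage, if_neg, LinearMap.zero_apply]
  intro h
  have hinj : Function.Injective fun s => (⟨a s, h.2 s⟩ : Fin q) := fun s t hst =>
    a.injective (Fin.ext (by simpa using hst))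
  have := Fintype.card_le_of_injective _ hinj
  simp at this
  omega

/-- Converse to `ActsBy.wedge_comm`. In a monomial containing an index ≥ p, this index is moved to
the front and stripped off by the relation, lowering the degree. Otherwise all indices are < p: the
length is either below p, where T vanishes, or exactly p, and the monomial is a permutation of the
one in `hdeg`. -/
lemma ActsBy.of_wedge_comm {b B : Module.Basis (Fin n) ℂ (V n)} {p q : ℕ} {c : ℂ} (hpq : p ≤ q)
    (hp : p ≤ n) {T : ExtFamily n}
    (hcomm : ∀ i m, T (m + 1) ∘ₗ wedge m (relVec b B p q i).1 = wedge m (relVec b B p q i).2 ∘ₗ T m)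
    (hlt : ∀ m < p, T m = 0)
    (hdeg : T p (exteriorPower.ιMulti ℂ p fun i => b (Fin.castLE hp i)) =
      c • exteriorPower.ιMulti ℂ p fun i => B (Fin.castLE hp i)) :
    ActsBy b B p q c T := by
  intro m
  induction m with
  | zero =>
    intro a
    rcases Nat.eq_zero_or_pos p with rfl | h0
    · have : a = Fin.castLE hp := Subsingleton.elim _ _
      subst this
      rw [hdeg, monomialImage, if_pos (admissible_castLE le_rfl hpq hp)]
    · rw [hlt 0 h0, LinearMap.zero_apply, monomialImage,
        if_neg fun h => absurd (h.le hp) (not_le.2 h0)]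
  | succ m ih =>
    intro a
    by_cases hinj : Function.Injective a
    swap
    · rw [ιMulti_not_injective b hinj, monomialImage_not_injective B p q c hinj, map_zero]
    by_cases hex : ∃ s, p ≤ (a s : ℕ)
    · obtain ⟨s, hs⟩ := hex
      obtain ⟨a', ha'⟩ : ∃ a' : Fin m → Fin n,
          a ∘ Equiv.swap 0 s = (Fin.cons (a s) a' : Fin (m + 1) → Fin n) := by
        refine ⟨Fin.tail (a ∘ Equiv.swap 0 s), ?_⟩
        rw [show a s = (a ∘ Equiv.swap 0 s) 0 by simp, Fin.cons_self_tail]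
      have h1 := LinearMap.congr_fun (hcomm (a s) m)
        (exteriorPower.ιMulti ℂ m fun t => b (a' t))
      rw [LinearMap.comp_apply, LinearMap.comp_apply, ih a'] at h1
      have h2 := wedge_monomialImage B p q c hpq (a s) a'
      simp only [relVec] at h1
      rw [h2, if_neg (not_lt.2 hs), if_neg (not_lt.2 hs), wedge_ιMulti] at h1
      have h3 : (Fin.cons (b (a s)) fun t => b (a' t) : Fin (m + 1) → V n) =
          fun t => b ((a ∘ Equiv.swap 0 s) t) := by
        funext t
        rw [ha']
        refine Fin.cases ?_ (fun t => ?_) t <;> simp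
      rw [h3, ← ha', ιMulti_comp_perm, monomialImage_comp_perm, Units.smul_def, map_zsmul,
        ← Units.smul_def] at h1
      exact smul_left_cancel _ h1
    · push Not at hex
      have hinj' : Function.Injective fun s => (⟨a s, hex s⟩ : Fin p) := fun s t hst =>
        hinj (Fin.ext (by simpa using hst))
      have hle : m + 1 ≤ p := by simpa using Fintype.card_le_of_injective _ hinj'
      rcases hle.lt_or_eq with hlt' | rfl
      · rw [hlt _ hlt', LinearMap.zero_apply, monomialImage,
          if_neg fun h => absurd (h.le hp) (not_le.2 hlt')]
      · let σ : Equiv.Perm (Fin (m + 1)) :=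
          Equiv.ofBijective _ (Finite.injective_iff_bijective.1 hinj')
        have ha : a = Fin.castLE hp ∘ σ := by
          funext s
          exact Fin.ext rfl
        rw [ha, ιMulti_comp_perm, monomialImage_comp_perm, Units.smul_def, map_zsmul, hdeg,
          monomialImage, if_pos (admissible_castLE le_rfl hpq hp), ← Units.smul_def]

/-- The operators `λ(S)` are well defined up to a nonzero factor. -/
lemma IsLambda.exists_smul_eq {S : Gr n} {T T' : ExtFamily n} (hT : IsLambda S T)
    (hT' : IsLambda S T') : ∃ κ : ℂ, T' = fun m => κ • T m := by
  obtain ⟨b, B, p, q, c, hpq, hq, hc, hS, hact⟩ := isLambda_iff.1 hT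
  obtain ⟨b', B', p', q', c', hpq', hq', hc', hS', hact'⟩ := isLambda_iff.1 hT'
  obtain rfl : p' = p := by rw [← finrank_indef hS' hpq' hq', finrank_indef hS hpq hq]
  have hp : p' ≤ n := hpq.trans hq
  -- Both pairs of bases span the same indeterminacy, so T' has its degree-p values in the line
  -- described by `B`.
  have hmem : ∀ ω, T' p' ω ∈
      Submodule.span ℂ {exteriorPower.ιMulti ℂ p' fun i => B (Fin.castLE hp i)} := by
    intro ω
    refine (Submodule.span_singleton_le_iff_mem _ _).2 ?_ (hact'.apply_mem_span hp ω)
    refine mem_span_ιMulti_of_mem_span (B.linearIndependent.comp _ (Fin.castLE_injective hp))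
      (ιMulti_basis_ne_zero B (Fin.castLE_injective hp)) fun i => ?_
    have : B' (Fin.castLE hp i) ∈ S.indef := by
      rw [indef_eq_span hS' hpq' hp]
      exact Submodule.subset_span ⟨i, rfl⟩
    rwa [indef_eq_span hS hpq hp] at this
  obtain ⟨d, hd⟩ := Submodule.mem_span_singleton.1
    (hmem (exteriorPower.ιMulti ℂ p' fun i => b (Fin.castLE hp i)))
  -- The vectors of the first pair of bases also lie in S, so T' satisfies the intertwining relation
  -- for them.
  have hact2 : ActsBy b B p' q d T' := ActsBy.of_wedge_comm hpq hp
    (fun i m => hact'.wedge_comm hpq' (by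
      rw [← hS', hS]
      exact Submodule.subset_span ⟨i, rfl⟩) m)
    (fun m hm => hact'.eq_zero_of_lt hp hm) hd.symm
  refine ⟨d / c, funext fun m => exteriorPower_hom_ext b fun a => ?_⟩
  rw [LinearMap.smul_apply, hact2, hact]
  unfold monomialImage
  split_ifs
  · rw [smul_smul, div_mul_cancel₀ _ hc]
  · simp

end

section

/-! ## Factorization of meromorphic matrices -/

/-- A quotient of meromorphic functions is holomorphic if it has no pole. -/
lemma exists_analyticAt_mul_eq {f g : ℂ → ℂ} (hf : MeromorphicAt f 0) (hg : MeromorphicAt g 0)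
    (hle : meromorphicOrderAt g 0 ≤ meromorphicOrderAt f 0)
    (htop : meromorphicOrderAt g 0 ≠ ⊤) :
    ∃ c : ℂ → ℂ, AnalyticAt ℂ c 0 ∧ ∀ᶠ z in 𝓝[≠] (0 : ℂ), f z = c z * g z := by
  by_cases hft : meromorphicOrderAt f 0 = ⊤
  · refine ⟨fun _ => 0, analyticAt_const, ?_⟩
    filter_upwards [meromorphicOrderAt_eq_top_iff.1 hft] with z hz
    simp [hz]
  · obtain ⟨r, hr⟩ := WithTop.ne_top_iff_exists.1 htop
    obtain ⟨s, hs⟩ := WithTop.ne_top_iff_exists.1 hft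
    obtain ⟨u, hu, hu0, hgu⟩ := (meromorphicOrderAt_eq_int_iff hg).1 hr.symm
    obtain ⟨w, hw, _, hfw⟩ := (meromorphicOrderAt_eq_int_iff hf).1 hs.symm
    have hrs : r ≤ s := by
      rw [← hr, ← hs] at hle
      exact_mod_cast hle
    refine ⟨fun z => z ^ (s - r).toNat * w z * (u z)⁻¹,
      ((analyticAt_id.pow _).mul hw).mul (hu.inv hu0), ?_⟩
    have hne : ∀ᶠ z in 𝓝[≠] (0 : ℂ), u z ≠ 0 :=
      (hu.continuousAt.eventually_ne hu0).filter_mono nhdsWithin_le_nhds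
    filter_upwards [hgu, hfw, hne, self_mem_nhdsWithin] with z h1 h2 h3 h4
    have h4 : z ≠ 0 := h4
    have h5 : z ^ s = z ^ (s - r).toNat * z ^ r := by
      rw [← zpow_natCast, Int.toNat_of_nonneg (sub_nonneg.2 hrs), ← zpow_add₀ h4,
        sub_add_cancel]
    rw [h1, h2, sub_zero, smul_eq_mul, smul_eq_mul, h5]
    field_simp

section Germ

variable {α β : Type*} [Fintype α] [DecidableEq α] [Fintype β] [DecidableEq β]

/-- A germ at `0` of a holomorphic map to the invertible matrices. -/
def IsInvertibleGerm (a : ℂ → Matrix α α ℂ) : Prop :=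
  (∀ i j, AnalyticAt ℂ (fun z => a z i j) 0) ∧ IsUnit (a 0)

lemma IsInvertibleGerm.mul {a b : ℂ → Matrix α α ℂ} (ha : IsInvertibleGerm a)
    (hb : IsInvertibleGerm b) : IsInvertibleGerm fun z => a z * b z := by
  refine ⟨fun i j => ?_, ha.2.mul hb.2⟩
  simp only [Matrix.mul_apply]
  exact Finset.analyticAt_fun_sum _ fun k _ => (ha.1 i k).mul (hb.1 k j)

lemma IsInvertibleGerm.submatrix {a : ℂ → Matrix α α ℂ} (ha : IsInvertibleGerm a) (e f : β ≃ α) :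
    IsInvertibleGerm fun z => (a z).submatrix e f :=
  ⟨fun i j => ha.1 (e i) (f j), (Matrix.isUnit_submatrix_equiv e f).2 ha.2⟩

lemma IsInvertibleGerm.fromBlocks_diag {a : ℂ → Matrix α α ℂ} {b : ℂ → Matrix β β ℂ}
    (ha : IsInvertibleGerm a) (hb : IsInvertibleGerm b) :
    IsInvertibleGerm fun z => Matrix.fromBlocks (a z) 0 0 (b z) := by
  refine ⟨?_, ?_⟩
  · rintro (i | i) (j | j)
    · exact ha.1 i j
    · exact analyticAt_const
    · exact analyticAt_const
    · exact hb.1 i j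
  · rw [Matrix.isUnit_iff_isUnit_det, Matrix.det_fromBlocks_zero₂₁]
    exact ((Matrix.isUnit_iff_isUnit_det _).1 ha.2).mul ((Matrix.isUnit_iff_isUnit_det _).1 hb.2)

lemma isInvertibleGerm_upper {d : ℂ → Matrix α β ℂ} (hd : ∀ i j, AnalyticAt ℂ (fun z => d z i j) 0) :
    IsInvertibleGerm fun z => Matrix.fromBlocks (1 : Matrix α α ℂ) (d z) 0 (1 : Matrix β β ℂ) := by
  refine ⟨?_, ?_⟩
  · rintro (i | i) (j | j)
    · exact analyticAt_const
    · exact hd i j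
    · exact analyticAt_const
    · exact analyticAt_const
  · rw [Matrix.isUnit_iff_isUnit_det, Matrix.det_fromBlocks_zero₂₁]
    simp

lemma isInvertibleGerm_lower {c : ℂ → Matrix β α ℂ} (hc : ∀ i j, AnalyticAt ℂ (fun z => c z i j) 0) :
    IsInvertibleGerm fun z => Matrix.fromBlocks (1 : Matrix α α ℂ) 0 (c z) (1 : Matrix β β ℂ) := by
  refine ⟨?_, ?_⟩
  · rintro (i | i) (j | j)
    · exact analyticAt_const
    · exact analyticAt_const
    · exact hc i j
    · exact analyticAt_const
  · rw [Matrix.isUnit_iff_isUnit_det, Matrix.det_fromBlocks_zero₁₂]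
    simp

/-- Factorizations `a · diag(z^{-m_i}) · b` with invertible holomorphic `a` and `b`. -/
def HasFactorization (M : ℂ → Matrix α α ℂ) (m : α → ℤ) : Prop :=
  ∃ a b : ℂ → Matrix α α ℂ, IsInvertibleGerm a ∧ IsInvertibleGerm b ∧
    ∀ᶠ z in 𝓝[≠] (0 : ℂ), M z = a z * Matrix.diagonal (fun i => z ^ (-m i)) * b z

lemma HasFactorization.mul_mul {M a b : ℂ → Matrix α α ℂ} {m : α → ℤ} (h : HasFactorization M m)
    (ha : IsInvertibleGerm a) (hb : IsInvertibleGerm b) :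
    HasFactorization (fun z => a z * M z * b z) m := by
  obtain ⟨a', b', ha', hb', h⟩ := h
  refine ⟨_, _, ha.mul ha', hb'.mul hb, ?_⟩
  filter_upwards [h] with z hz
  simp only [hz, Matrix.mul_assoc]

lemma HasFactorization.congr {M M' : ℂ → Matrix α α ℂ} {m : α → ℤ} (h : HasFactorization M m)
    (hM : ∀ᶠ z in 𝓝[≠] (0 : ℂ), M' z = M z) : HasFactorization M' m := by
  obtain ⟨a, b, ha, hb, h⟩ := h
  refine ⟨a, b, ha, hb, ?_⟩
  filter_upwards [h, hM] with z hz hz'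
  rw [hz', hz]

/-- Rows, columns and exponents are reindexed independently: the third bijection is absorbed between
the factors. -/
lemma HasFactorization.submatrix {M : ℂ → Matrix α α ℂ} {m : α → ℤ} (h : HasFactorization M m)
    (e f g : β ≃ α) : HasFactorization (fun z => (M z).submatrix e f) (m ∘ g) := by
  obtain ⟨a, b, ha, hb, h⟩ := h
  refine ⟨_, _, ha.submatrix e g, hb.submatrix g f, ?_⟩
  filter_upwards [h] with z hz
  have : (Matrix.diagonal fun i => z ^ (-(m ∘ g) i)) =
      (Matrix.diagonal fun i => z ^ (-m i)).submatrix g g := by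
    rw [Matrix.submatrix_diagonal_equiv]
    rfl
  rw [hz, this, Matrix.submatrix_mul_equiv, Matrix.submatrix_mul_equiv]

lemma HasFactorization.fromBlocks {A : ℂ → Matrix α α ℂ} {D : ℂ → Matrix β β ℂ} {m : α → ℤ}
    {m' : β → ℤ} (hA : HasFactorization A m) (hD : HasFactorization D m') :
    HasFactorization (fun z => Matrix.fromBlocks (A z) 0 0 (D z)) (Sum.elim m m') := by
  obtain ⟨a, b, ha, hb, h⟩ := hA
  obtain ⟨a', b', ha', hb', h'⟩ := hD
  refine ⟨_, _, ha.fromBlocks_diag ha', hb.fromBlocks_diag hb', ?_⟩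
  filter_upwards [h, h'] with z hz hz'
  have : (Matrix.diagonal fun i => z ^ (-Sum.elim m m' i)) =
      Matrix.fromBlocks (Matrix.diagonal fun i => z ^ (-m i)) 0 0
        (Matrix.diagonal fun i => z ^ (-m' i)) := by
    rw [Matrix.fromBlocks_diagonal]
    congr 1
    funext i
    cases i <;> rfl
  rw [this, Matrix.fromBlocks_multiply, Matrix.fromBlocks_multiply, hz, hz']
  simp

end Germ

lemma hasFactorization_unit {g : ℂ → ℂ} (hg : MeromorphicAt g 0)
    (htop : meromorphicOrderAt g 0 ≠ ⊤) :
    ∃ m, HasFactorization (fun z => Matrix.of fun _ _ : Unit => g z) m := by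
  obtain ⟨r, hr⟩ := WithTop.ne_top_iff_exists.1 htop
  obtain ⟨u, hu, hu0, hgu⟩ := (meromorphicOrderAt_eq_int_iff hg).1 hr.symm
  refine ⟨fun _ => -r, fun _ => 1, fun z => Matrix.of fun _ _ => u z,
    ⟨fun _ _ => analyticAt_const, isUnit_one⟩, ⟨fun _ _ => hu, ?_⟩, ?_⟩
  · rw [Matrix.isUnit_iff_isUnit_det]
    simpa using hu0
  · filter_upwards [hgu] with z hz
    ext
    simp [hz, Matrix.mul_apply, Matrix.diagonal]

lemma exists_equiv_sum_unit {n : ℕ} (i : Fin (n + 1)) :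
    ∃ e : Fin n ⊕ Unit ≃ Fin (n + 1), e (Sum.inr ()) = i :=
  ⟨(Equiv.optionEquivSumPUnit (Fin n)).symm.trans (finSuccEquiv' i).symm, by simp⟩

/-- Meromorphic families of matrices that are generically invertible admit a factorization. -/
lemma exists_hasFactorization : ∀ {n : ℕ} (M : ℂ → Matrix (Fin n) (Fin n) ℂ)
    (_ : ∀ i j, MeromorphicAt (fun z => M z i j) 0) (_ : ∀ᶠ z in 𝓝[≠] (0 : ℂ), IsUnit (M z)),
    ∃ m, HasFactorization M m := by
  intro n
  induction n with
  | zero =>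
    intro M _ _
    exact ⟨0, fun _ => 1, fun _ => 1, ⟨fun i => i.elim0, isUnit_one⟩,
      ⟨fun i => i.elim0, isUnit_one⟩, Eventually.of_forall fun z => Subsingleton.elim _ _⟩
  | succ n ih =>
    intro M hM hunit
    -- The pivot: an entry of least order divides every other entry with a holomorphic quotient.
    obtain ⟨⟨i₀, j₀⟩, hmin⟩ := Finite.exists_min fun p : Fin (n + 1) × Fin (n + 1) =>
      meromorphicOrderAt (fun z => M z p.1 p.2) 0
    have hmin : ∀ i j, meromorphicOrderAt (fun z => M z i₀ j₀) 0 ≤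
        meromorphicOrderAt (fun z => M z i j) 0 := fun i j => hmin (i, j)
    have htop : meromorphicOrderAt (fun z => M z i₀ j₀) 0 ≠ ⊤ := by
      intro h
      have h0 : ∀ i j, ∀ᶠ z in 𝓝[≠] (0 : ℂ), M z i j = 0 := fun i j =>
        meromorphicOrderAt_eq_top_iff.1 (top_le_iff.1 (h ▸ hmin i j))
      obtain ⟨z, hz, hz'⟩ := (hunit.and (eventually_all.2 fun i => eventually_all.2 fun j =>
        h0 i j)).exists
      have : M z = 0 := by
        ext i j
        exact hz' i j
      rw [this] at hz
      exact not_isUnit_zero hz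
    obtain ⟨e, he⟩ := exists_equiv_sum_unit i₀
    obtain ⟨f, hf⟩ := exists_equiv_sum_unit j₀
    choose d hd hd' using fun i : Fin n => exists_analyticAt_mul_eq (hM (e (Sum.inl i)) j₀)
      (hM i₀ j₀) (hmin _ _) htop
    choose c hc hc' using fun j : Fin n => exists_analyticAt_mul_eq (hM i₀ (f (Sum.inl j)))
      (hM i₀ j₀) (hmin _ _) htop
    -- The Schur complement of the pivot. The pivot column is d times the pivot and the pivot row is
    -- the pivot times c, so no division appears.
    let S : ℂ → Matrix (Fin n) (Fin n) ℂ := fun z =>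
      Matrix.of fun i j => M z (e (Sum.inl i)) (f (Sum.inl j)) - d i z * M z i₀ j₀ * c j z
    let g : ℂ → Matrix Unit Unit ℂ := fun z => Matrix.of fun _ _ : Unit => M z i₀ j₀
    let U : ℂ → Matrix (Fin n) Unit ℂ := fun z => Matrix.of fun i _ => d i z
    let L : ℂ → Matrix Unit (Fin n) ℂ := fun z => Matrix.of fun _ j => c j z
    have hdec : ∀ᶠ z in 𝓝[≠] (0 : ℂ), (M z).submatrix e f =
        Matrix.fromBlocks 1 (U z) 0 1 * Matrix.fromBlocks (S z) 0 0 (g z) *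
          Matrix.fromBlocks 1 0 (L z) 1 := by
      filter_upwards [eventually_all.2 hd', eventually_all.2 hc'] with z hdz hcz
      rw [Matrix.fromBlocks_multiply, Matrix.fromBlocks_multiply]
      ext (i | i) (j | j)
      · simp [S, g, U, L, Matrix.mul_apply]
      · simp [S, g, U, L, Matrix.mul_apply, hf, hdz]
      · simp [S, g, U, L, Matrix.mul_apply, he, hcz, mul_comm]
      · simp [S, g, U, L, he, hf]
    have hSunit : ∀ᶠ z in 𝓝[≠] (0 : ℂ), IsUnit (S z) := by
      filter_upwards [hdec, hunit] with z hz hu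
      have h1 : IsUnit ((M z).submatrix e f) := (Matrix.isUnit_submatrix_equiv e f).2 hu
      rw [hz, Matrix.isUnit_iff_isUnit_det, Matrix.det_mul, Matrix.det_mul,
        Matrix.det_fromBlocks_zero₂₁ (S z)] at h1
      rw [Matrix.isUnit_iff_isUnit_det]
      exact isUnit_of_mul_isUnit_left (isUnit_of_mul_isUnit_right (isUnit_of_mul_isUnit_left h1))
    obtain ⟨m, hm⟩ := ih S (fun i j => (hM _ _).sub
      (((hd i).meromorphicAt.mul (hM _ _)).mul (hc j).meromorphicAt)) hSunit
    obtain ⟨m', hm'⟩ := hasFactorization_unit (hM i₀ j₀) htop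
    have hfac := ((hm.fromBlocks hm').mul_mul (isInvertibleGerm_upper (d := U) fun i _ => hd i)
      (isInvertibleGerm_lower (c := L) fun _ j => hc j)).congr hdec
    have := hfac.submatrix e.symm f.symm e.symm
    refine ⟨_, this.congr (Eventually.of_forall fun z => ?_)⟩
    ext i j
    simp

variable {n : ℕ}

/-- Existence of the exponents of a meromorphic family. -/
lemma exists_isExponents {γ : ℂ → GL (Fin n) ℂ} (hγ : IsMeromorphicFamily γ) :
    ∃ m, IsExponents γ m := by
  obtain ⟨m, hm⟩ := exists_hasFactorization (fun z => (γ z : Matrix (Fin n) (Fin n) ℂ)) hγ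
    (Eventually.of_forall fun z => (γ z).isUnit)
  let σ := Tuple.sort fun i => -m i
  have hσ : Monotone ((fun i => -m i) ∘ σ) := Tuple.monotone_sort _
  refine ⟨m ∘ σ, fun i j hij => neg_le_neg_iff.1 (hσ hij), ?_⟩
  exact hm.submatrix (Equiv.refl _) (Equiv.refl _) σ

end

section

/-! ## The limit relations -/

variable {n : ℕ}

/-- The number of exponents larger than `k`. -/
def numGT (m : Fin n → ℤ) (k : ℤ) : ℕ := (Finset.univ.filter fun i => k < m i).card

/-- The number of exponents not less than `k`. -/
def numGE (m : Fin n → ℤ) (k : ℤ) : ℕ := (Finset.univ.filter fun i => k ≤ m i).card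

/-- An initial segment of `Fin n` is determined by its cardinality. It converts the cuts p, q of a
basis into conditions on exponents. -/
lemma lt_card_filter_iff (P : Fin n → Prop) [DecidablePred P] (hP : ∀ i j, i ≤ j → P j → P i)
    (i : Fin n) : (i : ℕ) < (Finset.univ.filter P).card ↔ P i := by
  constructor
  · intro h
    by_contra hi
    have hsub : Finset.univ.filter P ⊆ Finset.univ.filter fun j : Fin n => (j : ℕ) < i := by
      intro j hj
      simp only [Finset.mem_filter, Finset.mem_univ, true_and] at hj ⊢
      by_contra hlt
      exact hi (hP i j (by simpa using hlt) hj)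
    have := Finset.card_le_card hsub
    rw [Fin.card_filter_val_lt] at this
    omega
  · intro h
    have hsub : (Finset.univ.filter fun j : Fin n => (j : ℕ) < i + 1) ⊆ Finset.univ.filter P := by
      intro j hj
      simp only [Finset.mem_filter, Finset.mem_univ, true_and] at hj ⊢
      exact hP j i (Fin.le_def.2 (by omega)) h
    have := Finset.card_le_card hsub
    rw [Fin.card_filter_val_lt] at this
    omega

lemma lt_numGT_iff {m : Fin n → ℤ} (hm : Antitone m) (k : ℤ) (i : Fin n) :
    (i : ℕ) < numGT m k ↔ k < m i :=
  lt_card_filter_iff _ (fun _ _ hij h => lt_of_lt_of_le h (hm hij)) i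

lemma lt_numGE_iff {m : Fin n → ℤ} (hm : Antitone m) (k : ℤ) (i : Fin n) :
    (i : ℕ) < numGE m k ↔ k ≤ m i :=
  lt_card_filter_iff _ (fun _ _ hij h => le_trans h (hm hij)) i

lemma numGT_le_numGE (m : Fin n → ℤ) (k : ℤ) : numGT m k ≤ numGE m k :=
  Finset.card_le_card fun i hi => by
    simp only [Finset.mem_filter, Finset.mem_univ, true_and] at hi ⊢
    exact hi.le

lemma numGE_le (m : Fin n → ℤ) (k : ℤ) : numGE m k ≤ n := by
  exact (Finset.card_le_univ _).trans_eq (Fintype.card_fin n)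

/-- First components kill the coefficients with i ≥ p, second components those with i < q; as p ≤ q,
nothing is left. -/
lemma linearIndependent_relVec (b B : Module.Basis (Fin n) ℂ (V n)) {p q : ℕ} (hpq : p ≤ q) :
    LinearIndependent ℂ (relVec b B p q) := by
  rw [Fintype.linearIndependent_iff]
  intro c hc i
  have h1 : ∑ i : Fin n, (if (i : ℕ) < p then 0 else c i) • b i = 0 := by
    rw [← show _ = (0 : V n) from congrArg Prod.fst hc, Prod.fst_sum]
    refine Finset.sum_congr rfl fun i _ => ?_
    simp only [relVec, Prod.smul_fst]
    split_ifs <;> simp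
  have h2 : ∑ i : Fin n, (if (i : ℕ) < q then c i else 0) • B i = 0 := by
    rw [← show _ = (0 : V n) from congrArg Prod.snd hc, Prod.snd_sum]
    refine Finset.sum_congr rfl fun i _ => ?_
    simp only [relVec, Prod.smul_snd]
    split_ifs <;> simp
  have h1 := Fintype.linearIndependent_iff.1 b.linearIndependent _ h1 i
  have h2 := Fintype.linearIndependent_iff.1 B.linearIndependent _ h2 i
  by_cases hi : (i : ℕ) < p
  · simpa [hi.trans_le hpq] using h2
  · simpa [hi] using h1

/-- The images of the standard basis under an invertible operator. -/
def mapBasis (α : V n ≃ₗ[ℂ] V n) : Module.Basis (Fin n) ℂ (V n) := (Pi.basisFun ℂ (Fin n)).map α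

@[simp] lemma mapBasis_apply (α : V n ≃ₗ[ℂ] V n) (i : Fin n) :
    mapBasis α i = α (Pi.single i 1) := by
  simp [mapBasis]

variable (α β : V n ≃ₗ[ℂ] V n) (m : Fin n → ℤ)

/-- The frame `0 ⊕ α e_i` (`m_i > k`), `β⁻¹ e_i ⊕ α e_i` (`m_i = k`), `β⁻¹ e_i ⊕ 0` (`m_i < k`). -/
def limitFrame (k : ℤ) : Frame n :=
  ⟨relVec (mapBasis β.symm) (mapBasis α) (numGT m k) (numGE m k),
    linearIndependent_relVec _ _ (numGT_le_numGE m k)⟩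

/-- The limit of the graphs of `z^k α diag(z^{-m_i}) β` as `z → 0`. -/
def limitRel (k : ℤ) : Gr n := (limitFrame α β m k).span

lemma limitRel_coe (k : ℤ) : (limitRel α β m k).1 = Submodule.span ℂ
    (Set.range (relVec (mapBasis β.symm) (mapBasis α) (numGT m k) (numGE m k))) := rfl

variable {m} (hm : Antitone m)
include hm

/-- In the coordinates βx and α⁻¹y the relation splits into lines indexed by i, so the hinge axioms
reduce to inequalities between exponents. -/
lemma mem_limitRel (k : ℤ) (x y : V n) : (x, y) ∈ (limitRel α β m k).1 ↔
    ∀ i, (k < m i → β x i = 0) ∧ (m i < k → α.symm y i = 0) ∧ (m i = k → α.symm y i = β x i) := by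
  have hvec : ∀ i, relVec (mapBasis β.symm) (mapBasis α) (numGT m k) (numGE m k) i =
      (if k < m i then 0 else β.symm (Pi.single i 1),
        if k ≤ m i then α (Pi.single i 1) else 0) := by
    intro i
    simp only [relVec, lt_numGT_iff hm, lt_numGE_iff hm, mapBasis_apply]
  have hsum : ∀ c : Fin n → ℂ,
      ∑ i, c i • relVec (mapBasis β.symm) (mapBasis α) (numGT m k) (numGE m k) i =
        (β.symm fun i => if k < m i then 0 else c i, α fun i => if k ≤ m i then c i else 0) := by
    intro c
    apply Prod.ext
    · rw [Prod.fst_sum]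
      apply β.injective
      rw [map_sum, LinearEquiv.apply_symm_apply]
      simp only [hvec, Prod.smul_fst, map_smul, apply_ite β, map_zero,
        LinearEquiv.apply_symm_apply]
      funext j
      rw [Finset.sum_apply, Finset.sum_eq_single j]
      · split_ifs <;> simp
      · intro i _ hij
        split_ifs <;> simp [hij.symm]
      · simp
    · rw [Prod.snd_sum]
      apply α.symm.injective
      rw [map_sum, LinearEquiv.symm_apply_apply]
      simp only [hvec, Prod.smul_snd, map_smul, apply_ite α.symm, map_zero,
        LinearEquiv.symm_apply_apply]
      funext j
      rw [Finset.sum_apply, Finset.sum_eq_single j]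
      · split_ifs <;> simp
      · intro i _ hij
        split_ifs <;> simp [hij.symm]
      · simp
  rw [limitRel_coe, Submodule.mem_span_range_iff_exists_fun]
  constructor
  · rintro ⟨c, hc⟩ i
    rw [hsum, Prod.mk.injEq] at hc
    rw [← hc.1, ← hc.2, LinearEquiv.apply_symm_apply, LinearEquiv.symm_apply_apply]
    refine ⟨fun h => ?_, fun h => ?_, fun h => ?_⟩
    · simp [h]
    · simp [h]
    · simp [h]
  · intro h
    -- A coefficient with m_i > k is invisible in the first component and is read from y; the others
    -- are read from x.
    refine ⟨fun i => if k < m i then α.symm y i else β x i, ?_⟩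
    rw [hsum, Prod.mk.injEq]
    constructor
    · apply β.injective
      rw [LinearEquiv.apply_symm_apply]
      funext i
      split_ifs with hi
      · exact ((h i).1 hi).symm
      · rfl
    · apply α.symm.injective
      rw [LinearEquiv.symm_apply_apply]
      funext i
      rcases lt_trichotomy k (m i) with hi | hi | hi
      · simp [hi, hi.le]
      · simp [hi, ((h i).2.2 hi.symm)]
      · simp [not_le.2 hi, (h i).2.1 hi]

lemma mem_dom_limitRel (k : ℤ) (x : V n) :
    x ∈ (limitRel α β m k).dom ↔ ∀ i, k < m i → β x i = 0 := by
  simp only [Gr.dom, Submodule.mem_map, LinearMap.fst_apply, Prod.exists, exists_and_right,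
    exists_eq_right, mem_limitRel α β hm]
  constructor
  · rintro ⟨y, hy⟩ i
    exact (hy i).1
  · intro h
    refine ⟨α fun i => if m i = k then β x i else 0, fun i => ⟨h i, fun hi => ?_, fun hi => ?_⟩⟩
    · simp [hi.ne]
    · simp [hi]

lemma mem_im_limitRel (k : ℤ) (y : V n) :
    y ∈ (limitRel α β m k).im ↔ ∀ i, m i < k → α.symm y i = 0 := by
  simp only [Gr.im, Submodule.mem_map, LinearMap.snd_apply, Prod.exists,
    exists_eq_right, mem_limitRel α β hm]
  constructor
  · rintro ⟨x, hx⟩ i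
    exact (hx i).2.1
  · intro h
    refine ⟨β.symm fun i => if m i = k then α.symm y i else 0,
      fun i => ⟨fun hi => ?_, h i, fun hi => ?_⟩⟩
    · simp [hi.ne']
    · simp [hi]

lemma mem_ker_limitRel (k : ℤ) (x : V n) :
    x ∈ (limitRel α β m k).ker ↔ ∀ i, k ≤ m i → β x i = 0 := by
  show (x, (0 : V n)) ∈ (limitRel α β m k).1 ↔ _
  rw [mem_limitRel α β hm]
  refine forall_congr' fun i => ⟨fun h hi => ?_, fun h => ⟨fun hi => h hi.le, fun _ => by simp,
    fun hi => by simp [h hi.ge]⟩⟩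
  rcases hi.lt_or_eq with hi | hi
  · exact h.1 hi
  · simpa using (h.2.2 hi.symm).symm

lemma mem_indef_limitRel (k : ℤ) (y : V n) :
    y ∈ (limitRel α β m k).indef ↔ ∀ i, m i ≤ k → α.symm y i = 0 := by
  show ((0 : V n), y) ∈ (limitRel α β m k).1 ↔ _
  rw [mem_limitRel α β hm]
  refine forall_congr' fun i => ⟨fun h hi => ?_, fun h => ⟨fun _ => by simp, fun hi => h hi.le,
    fun hi => by simp [h hi.le]⟩⟩
  rcases hi.lt_or_eq with hi | hi
  · exact h.2.1 hi
  · simpa using h.2.2 hi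

omit hm in
lemma finrank_im_limitRel (k : ℤ) : Module.finrank ℂ (limitRel α β m k).im = numGE m k :=
  finrank_im (limitRel_coe α β m k) (numGE_le m k)

omit hm in
-- No exponent lies strictly between consecutive values of k. Both adjacency axioms of a hinge
-- follow from this.
lemma StrictAnti.lt_succ_iff {K : ℕ} {k : Fin K → ℤ} (hk : StrictAnti k)
    (hr : Set.range k = Set.range m) (j : ℕ) (hj : j + 1 < K) (i : Fin n) :
    k ⟨j + 1, hj⟩ < m i ↔ k ⟨j, Nat.lt_of_succ_lt hj⟩ ≤ m i := by
  obtain ⟨l, hl⟩ : m i ∈ Set.range k := hr ▸ ⟨i, rfl⟩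
  rw [← hl, hk.lt_iff_gt, hk.le_iff_ge, Fin.lt_def, Fin.le_def]
  exact Nat.lt_succ_iff

/-- The hinge formed by the limit relations. -/
def limitHinge {K : ℕ} (hK : 0 < K) (k : Fin K → ℤ) (hk : StrictAnti k)
    (hr : Set.range k = Set.range m) : Hinge n where
  k := K
  k_pos := hK
  P j := limitRel α β m (k j)
  ker_eq_dom j hj := by
    ext x
    simp only [mem_ker_limitRel α β hm, mem_dom_limitRel α β hm, StrictAnti.lt_succ_iff hk hr j hj]
  im_eq_indef j hj := by
    ext x
    simp only [mem_im_limitRel α β hm, mem_indef_limitRel α β hm, ← not_lt,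
      StrictAnti.lt_succ_iff hk hr j hj]
    simp only [not_lt, not_le]
  dom_first := by
    rw [eq_top_iff]
    intro x _
    rw [mem_dom_limitRel α β hm]
    intro i hi
    obtain ⟨l, hl⟩ : m i ∈ Set.range k := hr ▸ ⟨i, rfl⟩
    rw [← hl, hk.lt_iff_gt, Fin.lt_def] at hi
    simp at hi
  im_last := by
    rw [eq_top_iff]
    intro x _
    rw [mem_im_limitRel α β hm]
    intro i hi
    obtain ⟨l, hl⟩ : m i ∈ Set.range k := hr ▸ ⟨i, rfl⟩
    rw [← hl, hk.lt_iff_gt, Fin.lt_def] at hi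
    have := l.2
    simp only at hi
    omega
  ne_split j h := by
    obtain ⟨i, hi⟩ : k j ∈ Set.range m := hr ▸ ⟨j, rfl⟩
    -- An index with m_i = k_j gives a vector of the relation whose first component is not in the
    -- kernel.
    have hmem : (β.symm (Pi.single i 1), α (Pi.single i 1)) ∈ (limitRel α β m (k j)).1 := by
      rw [mem_limitRel α β hm]
      intro i'
      by_cases hii : i' = i
      · subst hii
        simp [hi]
      · simp [hii]
    rw [h, Submodule.mem_prod, mem_ker_limitRel α β hm] at hmem
    have := hmem.1 i hi.ge
    simp at this

omit hm in
lemma exists_strictAnti_range (hn : 1 ≤ n) (m : Fin n → ℤ) :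
    ∃ (K : ℕ) (k : Fin K → ℤ), 0 < K ∧ StrictAnti k ∧ Set.range k = Set.range m := by
  let s := Finset.univ.image m
  refine ⟨s.card, s.orderEmbOfFin rfl ∘ Fin.rev, ?_, ?_, ?_⟩
  · exact Finset.card_pos.2 ⟨m ⟨0, hn⟩, Finset.mem_image_of_mem _ (Finset.mem_univ _)⟩
  · exact (s.orderEmbOfFin rfl).strictMono.comp_strictAnti Fin.rev_strictAnti
  · rw [Fin.rev_surjective.range_comp, Finset.range_orderEmbOfFin]
    simp [s]

omit hm in
lemma StrictAnti.card_eq {K : ℕ} {k : Fin K → ℤ} (hk : StrictAnti k)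
    (hr : Set.range k = Set.range m) : K = (Set.range m).ncard := by
  rw [← hr, ← Set.image_univ, Set.ncard_image_of_injective _ hk.injective, Set.ncard_univ,
    Nat.card_eq_fintype_card, Fintype.card_fin]

omit hm in
lemma StrictAnti.eq_of_range_eq {K : ℕ} {k k' : Fin K → ℤ} (hk : StrictAnti k)
    (hk' : StrictAnti k') (hr : Set.range k = Set.range k') : k = k' := by
  have h := (StrictMono.range_inj (f := k ∘ Fin.rev) (g := k' ∘ Fin.rev)
    (hk.comp Fin.rev_strictAnti) (hk'.comp Fin.rev_strictAnti)).1
    (by rw [Fin.rev_surjective.range_comp, Fin.rev_surjective.range_comp, hr])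
  exact Fin.rev_surjective.injective_comp_right h

/-! ## Convergence to the limit relations -/

omit hm in
lemma tendsto_pow_toNat {f : ℤ} (hf : 0 < f) :
    Tendsto (fun z : ℂ => z ^ f.toNat) (𝓝[≠] 0) (𝓝 0) := by
  have : Tendsto (fun z : ℂ => z ^ f.toNat) (𝓝 0) (𝓝 (0 ^ f.toNat)) :=
    (continuous_pow _).tendsto 0
  rw [zero_pow (by omega)] at this
  exact this.mono_left nhdsWithin_le_nhds

omit hm in
lemma IsHolomorphicGerm.continuousAt {a : ℂ → Matrix (Fin n) (Fin n) ℂ}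
    (ha : IsHolomorphicGerm a) : ContinuousAt a 0 :=
  continuousAt_pi.2 fun i => continuousAt_pi.2 fun j => (ha.1 i j).continuousAt

omit hm in
lemma IsHolomorphicGerm.continuousAt_inv {a : ℂ → Matrix (Fin n) (Fin n) ℂ}
    (ha : IsHolomorphicGerm a) : ContinuousAt (fun z => (a z)⁻¹) 0 := by
  have hdet : (a 0).det ≠ 0 := ((Matrix.isUnit_iff_isUnit_det _).1 ha.2).ne_zero
  refine ContinuousAt.comp (f := a) (g := Inv.inv) (continuousAt_matrix_inv _ ?_) ha.continuousAt
  rw [Ring.inverse_eq_inv']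
  exact continuousAt_inv₀ hdet

omit hm in
lemma IsHolomorphicGerm.eventually_isUnit {a : ℂ → Matrix (Fin n) (Fin n) ℂ}
    (ha : IsHolomorphicGerm a) : ∀ᶠ z in 𝓝[≠] (0 : ℂ), IsUnit (a z) := by
  have hdet : (a 0).det ≠ 0 := ((Matrix.isUnit_iff_isUnit_det _).1 ha.2).ne_zero
  have hc : ContinuousAt (fun z => (a z).det) 0 :=
    (continuous_id.matrix_det).continuousAt.comp ha.continuousAt
  filter_upwards [(hc.eventually_ne hdet).filter_mono nhdsWithin_le_nhds] with z hz
  exact (Matrix.isUnit_iff_isUnit_det _).2 (isUnit_iff_ne_zero.2 hz)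

omit hm in
lemma tendsto_mulVec {a : ℂ → Matrix (Fin n) (Fin n) ℂ} (ha : ContinuousAt a 0) (v : V n) :
    Tendsto (fun z => (a z).mulVec v) (𝓝[≠] 0) (𝓝 ((a 0).mulVec v)) :=
  ((continuous_id.matrix_mulVec continuous_const).continuousAt.comp ha).tendsto.mono_left
    nhdsWithin_le_nhds

/-- The graph contains b⁻¹e_i ⊕ z^{k-m_i} a e_i. Multiplying by z^{m_i-k} when m_i > k removes the
pole, and the rescaled vectors tend to the independent vectors of `limitFrame`. `Int.toNat`
truncates the power in the component that needs none. -/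
lemma tendsto_limitRel {γ : ℂ → GL (Fin n) ℂ} {a b : ℂ → Matrix (Fin n) (Fin n) ℂ}
    (ha : IsHolomorphicGerm a) (hb : IsHolomorphicGerm b)
    (hγ : ∀ᶠ z in 𝓝[≠] (0 : ℂ),
      (γ z : Matrix (Fin n) (Fin n) ℂ) = a z * Matrix.diagonal (fun i => z ^ (-m i)) * b z)
    (hα : ∀ x, α x = (a 0).mulVec x) (hβ : ∀ x, β x = (b 0).mulVec x) (k : ℤ) :
    Tendsto (fun z : ℂ => Gr.graph (Matrix.toLin' (z ^ k • (γ z : Matrix (Fin n) (Fin n) ℂ))))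
      (𝓝[≠] 0) (𝓝 (limitRel α β m k)) := by
  let u : ℂ → Fin n → V n × V n := fun z i =>
    (z ^ (m i - k).toNat • (b z)⁻¹.mulVec (Pi.single i 1),
      z ^ (k - m i).toNat • (a z).mulVec (Pi.single i 1))
  have hβs : ∀ x, β.symm x = (b 0)⁻¹.mulVec x := by
    intro x
    rw [LinearEquiv.symm_apply_eq, hβ, Matrix.mulVec_mulVec,
      Matrix.mul_nonsing_inv _ ((Matrix.isUnit_iff_isUnit_det _).1 hb.2), Matrix.one_mulVec]
  have hu : Tendsto u (𝓝[≠] 0) (𝓝 (limitFrame α β m k).1) := by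
    rw [tendsto_pi_nhds]
    intro i
    have h1 := tendsto_mulVec hb.continuousAt_inv (Pi.single i 1)
    have h2 := tendsto_mulVec ha.continuousAt (Pi.single i 1)
    rw [← hβs] at h1
    rw [← hα] at h2
    have hv : (limitFrame α β m k).1 i =
        (if k < m i then 0 else β.symm (Pi.single i 1),
          if k ≤ m i then α (Pi.single i 1) else 0) := by
      simp only [limitFrame, relVec, lt_numGT_iff hm, lt_numGE_iff hm, mapBasis_apply]
    rw [hv]
    refine Tendsto.prodMk_nhds ?_ ?_
    · split_ifs with hi
      · simpa using (tendsto_pow_toNat (sub_pos.2 hi)).smul h1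
      · have : (m i - k).toNat = 0 := by omega
        simpa [this] using h1
    · split_ifs with hi
      · have : (k - m i).toNat = 0 := by omega
        simpa [this] using h2
      · simpa using (tendsto_pow_toNat (sub_pos.2 (not_le.1 hi))).smul h2
  have hopen : IsOpen {v : Fin n → V n × V n | LinearIndependent ℂ v} :=
    isOpen_setOfPred_linearIndependent
  refine Gr.tendsto_of_span _ hu ?_
  filter_upwards [hu (hopen.mem_nhds (limitFrame α β m k).2), hγ, hb.eventually_isUnit,
    self_mem_nhdsWithin] with z hli hz hbz hz0
  have hli : LinearIndependent ℂ (u z) := hli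
  have hz0 : z ≠ 0 := hz0
  symm
  refine Submodule.eq_of_le_of_finrank_eq ?_ ?_
  · rw [Submodule.span_le]
    rintro _ ⟨i, rfl⟩
    refine ⟨z ^ (m i - k).toNat • (b z)⁻¹.mulVec (Pi.single i 1), ?_⟩
    refine Prod.ext rfl ?_
    show Matrix.toLin' (z ^ k • (γ z : Matrix (Fin n) (Fin n) ℂ)) _ = _
    rw [Matrix.toLin'_apply, hz, Matrix.mulVec_smul, Matrix.smul_mulVec, Matrix.mulVec_mulVec,
      Matrix.mul_assoc, Matrix.mul_nonsing_inv _ ((Matrix.isUnit_iff_isUnit_det _).1 hbz),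
      Matrix.mul_one, ← Matrix.mulVec_mulVec]
    have : (Matrix.diagonal fun i => z ^ (-m i)).mulVec (Pi.single i 1) =
        z ^ (-m i) • (Pi.single i 1 : V n) := by
      rw [Matrix.mulVec_single_one]
      ext j
      by_cases hj : j = i
      · subst hj
        simp
      · simp [hj]
    rw [this, Matrix.mulVec_smul, smul_smul, smul_smul]
    show _ = z ^ (k - m i).toNat • _
    congr 1
    rw [← zpow_natCast, ← zpow_natCast, ← zpow_add₀ hz0, ← zpow_add₀ hz0]
    congr 1
    omega
  · rw [finrank_span_eq_card hli, Fintype.card_fin]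
    exact (Gr.graph _).2.symm

omit hm in
lemma exists_linearEquiv_mulVec {a : ℂ → Matrix (Fin n) (Fin n) ℂ} (ha : IsHolomorphicGerm a) :
    ∃ α : V n ≃ₗ[ℂ] V n, ∀ x, α x = (a 0).mulVec x :=
  ⟨Matrix.toLinearEquiv' (a 0) ha.2.invertible, fun _ => rfl⟩

end

section

/-! ## Limits of exterior powers -/

variable {n : ℕ}

lemma ActsBy.unique {b B : Module.Basis (Fin n) ℂ (V n)} {p q : ℕ} {c : ℂ} {T T' : ExtFamily n}
    (hT : ActsBy b B p q c T) (hT' : ActsBy b B p q c T') : T = T' :=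
  funext fun m => exteriorPower_hom_ext b fun a => by rw [hT, hT']

open Classical in
/-- The projection onto the span of the monomials `e_I` such that `I` contains all the indices
with `m_i > k` and consists of indices with `m_i ≥ k`. -/
def diagOp (m : Fin n → ℤ) (k : ℤ) : ExtFamily n := fun d =>
  ((Pi.basisFun ℂ (Fin n)).exteriorPower d).constr ℂ fun s =>
    if Admissible (numGT m k) (numGE m k) (Set.powersetCard.ofFinEmbEquiv.symm s) then
      (Pi.basisFun ℂ (Fin n)).exteriorPower d s else 0

open Classical in
lemma diagOp_ιMulti (m : Fin n → ℤ) (k : ℤ) {d : ℕ} (a : Fin d ↪o Fin n) :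
    diagOp m k d (exteriorPower.ιMulti ℂ d fun s => Pi.single (a s) 1) =
      if Admissible (numGT m k) (numGE m k) a then
        exteriorPower.ιMulti ℂ d fun s => Pi.single (a s) 1 else 0 := by
  have h : exteriorPower.ιMulti ℂ d (fun s => (Pi.single (a s) 1 : V n)) =
      (Pi.basisFun ℂ (Fin n)).exteriorPower d (Set.powersetCard.ofFinEmbEquiv a) := by
    rw [exteriorPower.basis_apply, exteriorPower.ιMulti_family, Equiv.symm_apply_apply]
    congr 1
    funext s
    simp
  rw [h, diagOp, Module.Basis.constr_basis, Equiv.symm_apply_apply]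

variable (α β : V n ≃ₗ[ℂ] V n) (m : Fin n → ℤ)

/-- The limits of the suitably normalized exterior powers of `α diag(z^{-m_i}) β`. -/
def limitOp (k : ℤ) : ExtFamily n := fun d =>
  exteriorPower.map d (α : V n →ₗ[ℂ] V n) * diagOp m k d * exteriorPower.map d (β : V n →ₗ[ℂ] V n)

lemma actsBy_limitOp (k : ℤ) :
    ActsBy (mapBasis β.symm) (mapBasis α) (numGT m k) (numGE m k) 1 (limitOp α β m k) := by
  refine actsBy_of_orderEmb fun d a => ?_
  rw [limitOp, Module.End.mul_apply, Module.End.mul_apply, exteriorPower.map_apply_ιMulti]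
  have : (β : V n →ₗ[ℂ] V n) ∘ (fun s => mapBasis β.symm (a s)) =
      fun s => Pi.single (a s) 1 := by
    funext s
    simp
  rw [this, diagOp_ιMulti, monomialImage, one_smul]
  split_ifs with h
  · rw [exteriorPower.map_apply_ιMulti]
    congr 1
    funext s
    simp
  · rw [map_zero]

lemma isLambda_limitOp (k : ℤ) : IsLambda (limitRel α β m k) (limitOp α β m k) :=
  isLambda_iff.2 ⟨_, _, _, _, 1, numGT_le_numGE m k, numGE_le m k, one_ne_zero,
    limitRel_coe α β m k, actsBy_limitOp α β m k⟩

lemma limitOp_ne_zero_iff (k : ℤ) (d : ℕ) :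
    limitOp α β m k d ≠ 0 ↔ numGT m k ≤ d ∧ d ≤ numGE m k := by
  constructor
  · intro h
    constructor
    · by_contra hd
      exact h ((actsBy_limitOp α β m k).eq_zero_of_lt
        ((numGT_le_numGE m k).trans (numGE_le m k)) (not_le.1 hd))
    · by_contra hd
      exact h ((actsBy_limitOp α β m k).eq_zero_of_gt (not_le.1 hd))
  · rintro ⟨h1, h2⟩
    exact (actsBy_limitOp α β m k).ne_zero one_ne_zero h1 h2 (numGE_le m k)

/-- The order of growth of the exterior power of degree `d` in the normalization determined by
`k`. -/
def growth (k : ℤ) (d : ℕ) : ℤ := ∑ i, max (m i - k) 0 + d * k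

/-- The sum of the `d` largest exponents. -/
def partialSum (d : ℕ) : ℤ := ∑ i : Fin n, if (i : ℕ) < d then m i else 0

open Classical in
-- The defect is a sum of local terms, each nonnegative; this yields both the bound and its equality
-- case.
lemma growth_sub_sum (k : ℤ) {d : ℕ} {a : Fin d → Fin n} (ha : Function.Injective a) :
    growth m k d - ∑ s, m (a s) =
      ∑ i, (max (m i - k) 0 - if i ∈ Set.range a then m i - k else 0) := by
  have h1 : ∑ i, (if i ∈ Set.range a then m i - k else 0) = ∑ s, (m (a s) - k) := by
    rw [← Finset.sum_filter]
    have : (Finset.univ.filter fun i => i ∈ Set.range a) = Finset.univ.map ⟨a, ha⟩ := by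
      ext i
      simp
    rw [this, Finset.sum_map]
    rfl
  rw [Finset.sum_sub_distrib, h1, Finset.sum_sub_distrib, growth]
  simp
  ring

lemma sum_le_growth (k : ℤ) {d : ℕ} {a : Fin d → Fin n} (ha : Function.Injective a) :
    0 ≤ growth m k d - ∑ s, m (a s) := by
  classical
  rw [growth_sub_sum m k ha]
  refine Finset.sum_nonneg fun i _ => ?_
  split_ifs
  · exact sub_nonneg.2 (le_max_left _ _)
  · simp

variable {m} (hm : Antitone m)
include hm

/-- The local term at i vanishes exactly when i is present if m_i > k and absent if m_i < k; for m_i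
= k it is always zero. -/
lemma admissible_iff (k : ℤ) {d : ℕ} {a : Fin d → Fin n} (ha : Function.Injective a) :
    Admissible (numGT m k) (numGE m k) a ↔ growth m k d - ∑ s, m (a s) = 0 := by
  classical
  rw [growth_sub_sum m k ha, Finset.sum_eq_zero_iff_of_nonneg]
  · unfold Admissible
    simp only [lt_numGT_iff hm, lt_numGE_iff hm]
    constructor
    · rintro ⟨h1, h2⟩ i _
      split_ifs with hi
      · obtain ⟨s, rfl⟩ := hi
        have := h2 s
        rw [max_eq_left (by omega)]
        ring
      · have : ¬ k < m i := fun h => hi (h1 i h)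
        rw [max_eq_right (by omega)]
        ring
    · intro h
      refine ⟨fun i hi => ?_, fun s => ?_⟩
      · by_contra hn
        have := h i (Finset.mem_univ _)
        rw [if_neg hn, max_eq_left (by omega)] at this
        omega
      · have := h (a s) (Finset.mem_univ _)
        rw [if_pos ⟨s, rfl⟩] at this
        have h2 := le_max_right (m (a s) - k) 0
        omega
  · intro i _
    split_ifs
    · exact sub_nonneg.2 (le_max_left _ _)
    · simp

lemma growth_eq_partialSum {k : ℤ} {d : ℕ} (h1 : numGT m k ≤ d) (h2 : d ≤ numGE m k) :
    growth m k d = partialSum m d := by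
  have hd : d ≤ n := h2.trans (numGE_le m k)
  have h3 : ∑ i : Fin n, (if (i : ℕ) < d then k else 0) = d * k := by
    rw [← Finset.sum_filter, Finset.sum_const, Fin.card_filter_val_lt, min_eq_right hd, nsmul_eq_mul]
  rw [growth, partialSum, ← h3, ← Finset.sum_add_distrib]
  refine Finset.sum_congr rfl fun i _ => ?_
  split_ifs with hi
  · have := (lt_numGE_iff hm k i).1 (hi.trans_le h2)
    rw [max_eq_left (by omega)]
    ring
  · have : ¬ k < m i := fun h => hi (((lt_numGT_iff hm k i).2 h).trans_le h1)
    rw [max_eq_right (by omega)]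
    ring

/-- In both windows admissibility says that the exponents of the tuple sum to `partialSum m d`,
which does not involve k. So operators of different levels agree in common degrees. -/
lemma limitOp_congr {k k' : ℤ} {d : ℕ} (h1 : numGT m k ≤ d) (h2 : d ≤ numGE m k)
    (h1' : numGT m k' ≤ d) (h2' : d ≤ numGE m k') : limitOp α β m k d = limitOp α β m k' d := by
  have : diagOp m k d = diagOp m k' d := by
    refine exteriorPower_hom_ext (W := ⋀[ℂ]^d (V n)) (Pi.basisFun ℂ (Fin n)) fun a => ?_
    simp only [Pi.basisFun_apply]
    rw [diagOp_ιMulti, diagOp_ιMulti]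
    simp only [admissible_iff hm _ a.injective, growth_eq_partialSum hm h1 h2,
      growth_eq_partialSum hm h1' h2']
  rw [limitOp, limitOp, this]

omit hm in
lemma WTendsto.exteriorPower_map {a : ℂ → Matrix (Fin n) (Fin n) ℂ} (ha : IsHolomorphicGerm a)
    (hα : ∀ x, α x = (a 0).mulVec x) (d : ℕ) :
    WTendsto (fun z => exteriorPower.map d (Matrix.toLin' (a z))) (𝓝[≠] 0)
      (exteriorPower.map d (α : V n →ₗ[ℂ] V n)) := by
  refine WTendsto.of_apply (exteriorPower.ιMulti_span ℂ d (V n)) ?_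
  rintro _ ⟨v, rfl⟩
  simp only [exteriorPower.map_apply_ιMulti]
  refine WTendsto.multilinear (exteriorPower.ιMulti ℂ d).toMultilinearMap
    (f := fun i z => Matrix.toLin' (a z) (v i)) (w := fun i => α (v i)) fun i => ?_
  refine WTendsto.of_tendsto ?_
  simp only [Matrix.toLin'_apply, hα]
  exact tendsto_mulVec ha.continuousAt (v i)

/-- On e_I the operator is multiplication by a power of z whose exponent is the defect: zero for
admissible I and positive otherwise. -/
lemma WTendsto.exteriorPower_diagonal (k : ℤ) (d : ℕ) :
    WTendsto (fun z : ℂ => z ^ growth m k d •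
      exteriorPower.map d (Matrix.toLin' (Matrix.diagonal fun i => z ^ (-m i)))) (𝓝[≠] 0)
      (diagOp m k d) := by
  classical
  refine WTendsto.of_apply ((Pi.basisFun ℂ (Fin n)).exteriorPower d).span_eq ?_
  rintro _ ⟨s, rfl⟩
  rw [exteriorPower.basis_apply]
  let a := Set.powersetCard.ofFinEmbEquiv.symm s
  have hs : exteriorPower.ιMulti_family ℂ d (Pi.basisFun ℂ (Fin n)) s =
      exteriorPower.ιMulti ℂ d fun t => (Pi.single (a t) 1 : V n) := by
    rw [exteriorPower.ιMulti_family]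
    congr 1
    funext t
    simp [a]
  rw [hs, diagOp_ιMulti]
  have hE := sum_le_growth m k a.injective
  have hlim : Tendsto (fun z : ℂ => z ^ (growth m k d - ∑ t, m (a t))) (𝓝[≠] 0)
      (𝓝 (if Admissible (numGT m k) (numGE m k) a then 1 else 0)) := by
    split_ifs with h
    · rw [(admissible_iff hm k a.injective).1 h]
      simp
    · have h' := mt (admissible_iff hm k a.injective).2 h
      have hpos : 0 < growth m k d - ∑ t, m (a t) := lt_of_le_of_ne hE (Ne.symm h')
      refine (tendsto_pow_toNat hpos).congr fun z => ?_
      rw [← zpow_natCast, Int.toNat_of_nonneg hE]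
  have := WTendsto.smul hlim
    (WTendsto.const (exteriorPower.ιMulti ℂ d fun t => (Pi.single (a t) 1 : V n)))
  rw [ite_smul, one_smul, zero_smul] at this
  refine this.congr' ?_
  filter_upwards [self_mem_nhdsWithin] with z hz
  have hz : z ≠ 0 := hz
  rw [LinearMap.smul_apply, exteriorPower.map_apply_ιMulti]
  have hvec : (Matrix.toLin' (Matrix.diagonal fun i => z ^ (-m i))) ∘
      (fun t => (Pi.single (a t) 1 : V n)) =
      fun t => z ^ (-m (a t)) • (Pi.single (a t) 1 : V n) := by
    funext t
    rw [Function.comp_apply, Matrix.toLin'_apply, Matrix.mulVec_single_one]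
    ext j
    by_cases hj : j = a t
    · subst hj
      simp
    · simp [hj]
  rw [hvec]
  have hsm := (exteriorPower.ιMulti ℂ d (M := V n)).toMultilinearMap.map_smul_univ
    (fun t => z ^ (-m (a t))) (fun t => (Pi.single (a t) 1 : V n))
  have hprod : ∀ u : Finset (Fin d), ∏ t ∈ u, z ^ (-m (a t)) = z ^ (-∑ t ∈ u, m (a t)) := by
    intro u
    induction u using Finset.induction_on with
    | empty => simp
    | insert t u ht ih =>
      rw [Finset.prod_insert ht, ih, Finset.sum_insert ht, neg_add, zpow_add₀ hz]
  rw [hprod] at hsm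
  refine Eq.trans ?_ (congrArg (z ^ growth m k d • ·) hsm.symm)
  show _ = z ^ growth m k d • z ^ (-∑ t, m (a t)) • _
  rw [smul_smul, ← zpow_add₀ hz, sub_eq_add_neg]
  rfl

lemma WTendsto.lambdaCha {γ : ℂ → GL (Fin n) ℂ} {a b : ℂ → Matrix (Fin n) (Fin n) ℂ}
    (ha : IsHolomorphicGerm a) (hb : IsHolomorphicGerm b)
    (hγ : ∀ᶠ z in 𝓝[≠] (0 : ℂ),
      (γ z : Matrix (Fin n) (Fin n) ℂ) = a z * Matrix.diagonal (fun i => z ^ (-m i)) * b z)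
    (hα : ∀ x, α x = (a 0).mulVec x) (hβ : ∀ x, β x = (b 0).mulVec x) {k : ℤ} {d : ℕ}
    (h1 : numGT m k ≤ d) (h2 : d ≤ numGE m k) :
    WTendsto (fun z => z ^ partialSum m d • glCha (γ z) d) (𝓝[≠] 0) (limitOp α β m k d) := by
  have h := ((WTendsto.exteriorPower_map α ha hα d).mul
    (WTendsto.exteriorPower_diagonal hm k d)).mul (WTendsto.exteriorPower_map β hb hβ d)
  refine h.congr' ?_
  filter_upwards [hγ] with z hz
  have hmul : glCha (γ z) d = exteriorPower.map d (Matrix.toLin' (a z)) *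
      exteriorPower.map d (Matrix.toLin' (Matrix.diagonal fun i => z ^ (-m i))) *
      exteriorPower.map d (Matrix.toLin' (b z)) := by
    rw [glCha, SeaUrchin.lambdaCha, hz, Matrix.toLin'_mul, Matrix.toLin'_mul,
      exteriorPower.map_comp, exteriorPower.map_comp]
    rfl
  rw [hmul, growth_eq_partialSum hm h1 h2, mul_smul_comm, smul_mul_assoc]

lemma numGT_apply_le (i : Fin n) : numGT m (m i) ≤ i := by
  by_contra h
  exact lt_irrefl _ ((lt_numGT_iff hm _ i).1 (not_le.1 h))

lemma lt_numGE_apply (i : Fin n) : (i : ℕ) < numGE m (m i) := (lt_numGE_iff hm _ i).2 le_rfl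

omit hm in
lemma partialSum_succ_sub (i : Fin n) : partialSum m (i + 1) - partialSum m i = m i := by
  rw [partialSum, partialSum, ← Finset.sum_sub_distrib, Finset.sum_eq_single i]
  · simp
  · intro j _ hj
    have : (j : ℕ) ≠ i := fun h => hj (Fin.ext h)
    split_ifs <;> omega
  · simp

omit hm in
/-- Uniqueness of the exponents. -/
lemma IsExponents.unique {γ : ℂ → GL (Fin n) ℂ} {m m' : Fin n → ℤ} (h : IsExponents γ m)
    (h' : IsExponents γ m') : m = m' := by
  obtain ⟨hm, a, b, ha, hb, hγ⟩ := h
  obtain ⟨hm', a', b', ha', hb', hγ'⟩ := h'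
  obtain ⟨α, hα⟩ := exists_linearEquiv_mulVec ha
  obtain ⟨β, hβ⟩ := exists_linearEquiv_mulVec hb
  obtain ⟨α', hα'⟩ := exists_linearEquiv_mulVec ha'
  obtain ⟨β', hβ'⟩ := exists_linearEquiv_mulVec hb'
  -- The window of the level m_i contains both degrees i and i + 1, so both partial sums are
  -- determined by nonzero limits; their difference is m_i.
  have key : ∀ (i : Fin n) (d : ℕ), (i : ℕ) ≤ d → d ≤ i + 1 → partialSum m d = partialSum m' d := by
    intro i d h1 h2
    have hd1 := (numGT_apply_le hm i).trans h1
    have hd2 := h2.trans (lt_numGE_apply hm i)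
    have hd1' := (numGT_apply_le hm' i).trans h1
    have hd2' := h2.trans (lt_numGE_apply hm' i)
    have hne := (limitOp_ne_zero_iff α β m (m i) d).2 ⟨hd1, hd2⟩
    have hne' := (limitOp_ne_zero_iff α' β' m' (m' i) d).2 ⟨hd1', hd2'⟩
    exact WTendsto.zpow_unique (W := Module.End ℂ (⋀[ℂ]^d (V n)))
      (WTendsto.lambdaCha α β hm ha hb hγ hα hβ hd1 hd2)
      (WTendsto.lambdaCha α' β' hm' ha' hb' hγ' hα' hβ' hd1' hd2') hne hne'
  funext i
  rw [← partialSum_succ_sub (m := m), ← partialSum_succ_sub (m := m'), key i i le_rfl (by omega),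
    key i (i + 1) (by omega) le_rfl]

/-! ## The canonical family of a limit hinge -/

omit hm in
lemma graph_constr {S : Gr n} {b B : Module.Basis (Fin n) ℂ (V n)} {q : ℕ}
    (hS : S.1 = Submodule.span ℂ (Set.range (relVec b B 0 q))) :
    S = Gr.graph (b.constr ℂ fun i => if (i : ℕ) < q then B i else 0) := by
  apply Subtype.ext
  refine Submodule.eq_of_le_of_finrank_eq ?_ (S.2.trans (Gr.graph _).2.symm)
  rw [hS, Submodule.span_le]
  rintro _ ⟨i, rfl⟩
  refine ⟨b i, Prod.ext ?_ ?_⟩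
  · simp [relVec]
  · exact b.constr_basis ℂ _ i

omit hm in
lemma Gr.graph_injective : Function.Injective (Gr.graph : (V n →ₗ[ℂ] V n) → Gr n) := by
  intro A A' h
  refine LinearMap.ext fun x => ?_
  have hx : ((x, A x) : V n × V n) ∈ (Gr.graph A').1 := by
    rw [← h]
    exact ⟨x, rfl⟩
  obtain ⟨y, hy⟩ := hx
  have h1 : y = x := congrArg Prod.fst hy
  have h2 : A' y = A x := congrArg Prod.snd hy
  rw [← h2, h1]

omit hm in
lemma actsBy_lambdaCha_constr (b B : Module.Basis (Fin n) ℂ (V n)) (q : ℕ) :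
    ActsBy b B 0 q 1 (lambdaCha (b.constr ℂ fun i => if (i : ℕ) < q then B i else 0)) := by
  intro d a
  rw [lambdaCha, exteriorPower.map_apply_ιMulti, monomialImage, one_smul]
  split_ifs with h
  · congr 1
    funext s
    exact (b.constr_basis ℂ _ _).trans (if_pos (h.2 s))
  · have : ∃ s, ¬ (a s : ℕ) < q := by
      by_contra! hs
      exact h ⟨fun i hi => absurd hi (Nat.not_lt_zero _), hs⟩
    obtain ⟨s, hs⟩ := this
    refine (exteriorPower.ιMulti ℂ d).map_coord_zero s ?_
    exact (b.constr_basis ℂ _ _).trans (if_neg hs)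

omit hm in
lemma eq_one_of_smul_eq_self {W : Type*} [AddCommGroup W] [Module ℂ W] {w : W} (hw : w ≠ 0)
    {κ : ℂ} (h : κ • w = w) : κ = 1 := by
  have : (κ - 1) • w = 0 := by rw [sub_smul, one_smul, h, sub_self]
  exact sub_eq_zero.1 ((smul_eq_zero.1 this).resolve_right hw)

section Lift

variable {K : ℕ} (hK : 0 < K) {k : Fin K → ℤ} (hk : StrictAnti k)
    (hr : Set.range k = Set.range m)
include hk hr

omit hm in
lemma numGT_first : numGT m (k ⟨0, hK⟩) = 0 := by
  rw [numGT, Finset.card_eq_zero, Finset.filter_eq_empty_iff]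
  intro i _ hi
  obtain ⟨l, hl⟩ : m i ∈ Set.range k := hr ▸ ⟨i, rfl⟩
  rw [← hl, hk.lt_iff_gt, Fin.lt_def] at hi
  simp at hi

omit hm in
-- Consecutive windows share an endpoint. It is the dimension of Im P_j, the degree in which the
-- normalization is imposed.
lemma numGT_succ (j : ℕ) (hj : j + 1 < K) :
    numGT m (k ⟨j + 1, hj⟩) = numGE m (k ⟨j, Nat.lt_of_succ_lt hj⟩) := by
  rw [numGT, numGE]
  congr 1
  ext i
  simp only [Finset.mem_filter, Finset.mem_univ, true_and]
  exact StrictAnti.lt_succ_iff hk hr j hj i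

lemma limitOp_succ (j : ℕ) (hj : j + 1 < K) :
    limitOp α β m (k ⟨j + 1, hj⟩) (numGE m (k ⟨j, Nat.lt_of_succ_lt hj⟩)) =
      limitOp α β m (k ⟨j, Nat.lt_of_succ_lt hj⟩)
        (numGE m (k ⟨j, Nat.lt_of_succ_lt hj⟩)) := by
  have h := numGT_succ hk hr j hj
  exact limitOp_congr α β hm h.le (h ▸ numGT_le_numGE m _) (numGT_le_numGE m _) le_rfl

omit hm in
-- No exponent exceeds the largest one, so p = 0 and the relation is a graph. The factor of
-- `limitOp` is 1, as the first normalization demands.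
lemma limitRel_first : ∃ A, limitRel α β m (k ⟨0, hK⟩) = Gr.graph A ∧
    limitOp α β m (k ⟨0, hK⟩) = lambdaCha A := by
  have hS := limitRel_coe α β m (k ⟨0, hK⟩)
  have hT := actsBy_limitOp α β m (k ⟨0, hK⟩)
  rw [numGT_first hK hk hr] at hS hT
  exact ⟨_, graph_constr hS, hT.unique (actsBy_lambdaCha_constr _ _ _)⟩

omit hk in
lemma exists_between {d : ℕ} (hn : 1 ≤ n) (hd : d ≤ n) :
    ∃ j, numGT m (k j) ≤ d ∧ d ≤ numGE m (k j) := by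
  obtain ⟨i, h1, h2⟩ : ∃ i : Fin n, (i : ℕ) ≤ d ∧ d ≤ i + 1 := by
    -- For d = 0 truncated subtraction gives index 0, which exists as n ≥ 1 and whose window also
    -- contains degree 0.
    refine ⟨⟨d - 1, by omega⟩, ?_, ?_⟩ <;> simp only <;> omega
  obtain ⟨j, hj⟩ : m i ∈ Set.range k := hr ▸ ⟨i, rfl⟩
  refine ⟨j, ?_, ?_⟩
  · rw [hj]
    exact (numGT_apply_le hm i).trans h1
  · rw [hj]
    exact h2.trans (lt_numGE_apply hm i)

/-- The operators `limitOp` themselves meet the normalization. Existence is needed because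
`Hinge.lift` is 0 by default. -/
lemma exists_isLift_limitHinge (hn : 1 ≤ n) :
    ∃ L, (limitHinge α β hm hK k hk hr).IsLift L := by
  classical
  refine ⟨fun d => if h : d ≤ n then
      limitOp α β m (k (exists_between hm hr hn h).choose) d else 0,
    fun j => limitOp α β m (k j), fun j => isLambda_limitOp α β m (k j), fun A hA => ?_,
    fun j hj => ?_, fun d hd => ?_⟩
  · obtain ⟨A', h1, h2⟩ := limitRel_first α β hK hk hr
    have : Gr.graph A' = Gr.graph A := h1.symm.trans hA
    rw [← Gr.graph_injective this]
    exact h2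
  · rw [show Module.finrank ℂ ((limitHinge α β hm hK k hk hr).P ⟨j, Nat.lt_of_succ_lt hj⟩).im =
      numGE m (k ⟨j, Nat.lt_of_succ_lt hj⟩) from finrank_im_limitRel α β _]
    exact limitOp_succ α β hm hk hr j hj
  · refine ⟨(exists_between hm hr hn hd).choose, ?_, ?_⟩
    · exact (limitOp_ne_zero_iff _ _ _ _ _).2 (exists_between hm hr hn hd).choose_spec
    · simp only [dif_pos hd]

/-- Whatever bases are chosen, λ(P_{j+1}) is a multiple of `limitOp`; in the degree shared with P_j
both are already known and nonzero, so the factor is 1. Induction on j starts from the graph P_1. -/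
lemma IsLift.eq_limitOp {L : ExtFamily n} (hL : (limitHinge α β hm hK k hk hr).IsLift L)
    {d : ℕ} {l : ℤ} (h1 : numGT m l ≤ d) (h2 : d ≤ numGE m l) : L d = limitOp α β m l d := by
  obtain ⟨T, hlam, hfirst, hnorm, hL⟩ := hL
  have hT : ∀ (j : ℕ) (hj : j < K), T ⟨j, hj⟩ = limitOp α β m (k ⟨j, hj⟩) := by
    intro j
    induction j with
    | zero =>
      intro hj
      obtain ⟨A, hA1, hA2⟩ := limitRel_first α β hK hk hr
      rw [hA2]
      exact hfirst A hA1
    | succ j ih =>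
      intro hj
      obtain ⟨κ, hκ⟩ := (isLambda_limitOp α β m (k ⟨j + 1, hj⟩)).exists_smul_eq (hlam ⟨j + 1, hj⟩)
      have hn : κ • limitOp α β m (k ⟨j + 1, hj⟩) (numGE m (k ⟨j, Nat.lt_of_succ_lt hj⟩)) =
          limitOp α β m (k ⟨j + 1, hj⟩) (numGE m (k ⟨j, Nat.lt_of_succ_lt hj⟩)) := by
        have h := hnorm j hj
        rw [show Module.finrank ℂ ((limitHinge α β hm hK k hk hr).P ⟨j, Nat.lt_of_succ_lt hj⟩).im =
          numGE m (k ⟨j, Nat.lt_of_succ_lt hj⟩) from finrank_im_limitRel α β _] at h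
        exact (congrFun hκ _).symm.trans (h.trans
          ((congrFun (ih (Nat.lt_of_succ_lt hj)) _).trans (limitOp_succ α β hm hk hr j hj).symm))
      have hne : limitOp α β m (k ⟨j + 1, hj⟩) (numGE m (k ⟨j, Nat.lt_of_succ_lt hj⟩)) ≠ 0 := by
        rw [limitOp_ne_zero_iff, ← numGT_succ hk hr j hj]
        exact ⟨le_rfl, numGT_le_numGE m _⟩
      have hκ1 : κ = 1 := eq_one_of_smul_eq_self
        (W := Module.End ℂ (⋀[ℂ]^(numGE m (k ⟨j, Nat.lt_of_succ_lt hj⟩)) (V n))) hne hn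
      rw [hκ, hκ1]
      funext d
      rw [one_smul]
  obtain ⟨⟨j, hj⟩, hj1, hj2⟩ := hL d (h2.trans (numGE_le m l))
  rw [hT j hj] at hj1 hj2
  obtain ⟨h1', h2'⟩ := (limitOp_ne_zero_iff _ _ _ _ _).1 hj1
  rw [hj2]
  exact limitOp_congr α β hm h1' h2' h1 h2

lemma lift_limitHinge (hn : 1 ≤ n) {d : ℕ} {l : ℤ} (h1 : numGT m l ≤ d) (h2 : d ≤ numGE m l) :
    (limitHinge α β hm hK k hk hr).lift d = limitOp α β m l d := by
  have hex := exists_isLift_limitHinge α β hm hK hk hr hn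
  rw [Hinge.lift, dif_pos hex]
  exact IsLift.eq_limitOp α β hm hK hk hr hex.choose_spec h1 h2

end Lift

end

section

/-! ## Limits in the representations -/

variable {n : ℕ}

lemma WTendsto.sum {α W κ : Type*} [Fintype κ] {l : Filter α} [AddCommMonoid W] [Module ℂ W]
    {f : κ → α → W} {w : κ → W} (h : ∀ i, WTendsto (f i) l (w i)) :
    WTendsto (fun z => ∑ i, f i z) l (∑ i, w i) := fun φ => by
  simp only [map_sum]
  exact tendsto_finsetSum _ fun i _ => h i φ

lemma WTendsto.piMap {α κ : Type*} [Fintype κ] {E : κ → Type*} [∀ i, AddCommMonoid (E i)]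
    [∀ i, Module ℂ (E i)] [∀ i, Module.Finite ℂ (E i)] {l : Filter α}
    {f : ∀ i, α → Module.End ℂ (E i)} {A : ∀ i, Module.End ℂ (E i)}
    (h : ∀ i, WTendsto (f i) l (A i)) :
    WTendsto (fun z => LinearMap.piMap fun i => f i z) l (LinearMap.piMap A) := by
  classical
  have key : ∀ (B : ∀ i, Module.End ℂ (E i)) (x : ∀ i, E i),
      LinearMap.piMap B x = ∑ i, LinearMap.single ℂ E i (B i (x i)) := by
    intro B x
    exact (Finset.univ_sum_single _).symm
  refine WTendsto.of_apply (s := Set.univ) Submodule.span_univ fun x _ => ?_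
  simp only [key]
  exact WTendsto.sum fun i => ((h i).apply (x i)).linear (LinearMap.single ℂ E i)

lemma exists_dual_extension {W : Type*} [AddCommMonoid W] [Module ℂ W] {p : Submodule ℂ W}
    (φ : Module.Dual ℂ p) : ∃ Φ : Module.Dual ℂ W, ∀ y : p, φ y = Φ y := by
  let : AddCommGroup W := Module.addCommMonoidToAddCommGroup ℂ
  obtain ⟨Φ, hΦ⟩ := LinearMap.exists_extend φ
  exact ⟨Φ, fun y => (LinearMap.congr_fun hΦ y).symm⟩

/-- Abel summation. The function `N` extends ν by zero; the boundary terms vanish since N n = 0 and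
the empty partial sum is 0. -/
lemma weight_eq_sum_factors (m : Fin n → ℤ) {ν : Fin n → ℕ} (hν : Antitone ν) :
    ∑ x : Factors ν, partialSum m ((x.1 : ℕ) + 1) = weight m ν := by
  let N : ℕ → ℤ := fun j => if h : j < n then (ν ⟨j, h⟩ : ℤ) else 0
  have hmult : ∀ j : Fin n, (mult ν j : ℤ) = N j - N (j + 1) := by
    intro j
    have h1 : N j = ν j := by simp [N]
    rw [h1, mult]
    by_cases h : (j : ℕ) + 1 < n
    · have h2 : N (j + 1) = ν ⟨j + 1, h⟩ := by simp [N, h]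
      rw [dif_pos h, h2, Nat.cast_sub (hν (Fin.le_def.2 (by simp)))]
    · have h2 : N (j + 1) = 0 := by simp [N, h]
      rw [dif_neg h, h2]
      simp
  rw [Fintype.sum_sigma, weight, ← sub_eq_zero, ← Finset.sum_sub_distrib]
  have hterm : ∀ j : Fin n, (∑ _ : Fin (mult ν j), partialSum m ((j : ℕ) + 1)) - m j * (ν j : ℤ) =
      N j * partialSum m j - N (j + 1) * partialSum m (j + 1) := by
    intro j
    have h1 : N j = ν j := by simp [N]
    rw [Finset.sum_const, Finset.card_univ, Fintype.card_fin, nsmul_eq_mul, hmult, ← h1,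
      ← partialSum_succ_sub (m := m) j]
    ring
  rw [Finset.sum_congr rfl fun j _ => hterm j,
    Fin.sum_univ_eq_sum_range fun j => N j * partialSum m j - N (j + 1) * partialSum m (j + 1),
    Finset.sum_range_sub']
  simp [N, partialSum]

lemma WTendsto.bigR {γ : ℂ → GL (Fin n) ℂ} {m : Fin n → ℤ} {L : ExtFamily n}
    (hL : ∀ j : Fin n, WTendsto (fun z => z ^ partialSum m ((j : ℕ) + 1) • glCha (γ z) ((j : ℕ) + 1))
      (𝓝[≠] 0) (L ((j : ℕ) + 1))) {ν : Fin n → ℕ} (hν : Antitone ν) :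
    WTendsto (fun z => z ^ weight m ν • SeaUrchin.bigR ν (glCha (γ z))) (𝓝[≠] 0)
      (SeaUrchin.bigR ν L) := by
  have h := WTendsto.multilinear
    (PiTensorProduct.mapMultilinear ℂ (fun x : Factors ν => ⋀[ℂ]^((x.1 : ℕ) + 1) (V n))
      (fun x : Factors ν => ⋀[ℂ]^((x.1 : ℕ) + 1) (V n)))
    (f := fun x z => z ^ partialSum m ((x.1 : ℕ) + 1) • glCha (γ z) ((x.1 : ℕ) + 1))
    (w := fun x => L ((x.1 : ℕ) + 1)) fun x => hL x.1
  refine h.congr' ?_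
  filter_upwards [self_mem_nhdsWithin] with z hz
  have hz : z ≠ 0 := hz
  rw [MultilinearMap.map_smul_univ]
  have hprod : ∀ u : Finset (Factors ν), ∏ x ∈ u, z ^ partialSum m ((x.1 : ℕ) + 1) =
      z ^ ∑ x ∈ u, partialSum m ((x.1 : ℕ) + 1) := by
    classical
    intro u
    induction u using Finset.induction_on with
    | empty => simp
    | insert t u ht ih => rw [Finset.prod_insert ht, ih, Finset.sum_insert ht, zpow_add₀ hz]
  rw [hprod, weight_eq_sum_factors m hν]
  rfl

instance finite_bigH (ν : Fin n → ℕ) : Module.Finite ℂ (BigH ν) := PiTensorProduct.finite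

instance finite_H (ν : Fin n → ℕ) : Module.Finite ℂ (H ν) := finite_submodule (H ν)

/-- A linear subspace is closed under weak limits. Without this invariance `rhoExt` would take its
default value 0. -/
lemma bigR_limit_mem {γ : ℂ → GL (Fin n) ℂ} {ν : Fin n → ℕ} {L : ExtFamily n} {w : ℤ}
    (h : WTendsto (fun z => z ^ w • bigR ν (glCha (γ z))) (𝓝[≠] 0) (bigR ν L)) :
    ∀ x ∈ H ν, bigR ν L x ∈ H ν := fun x hx =>
  WTendsto.mem (W := BigH ν) (h.apply x) (H ν) (Eventually.of_forall fun z =>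
    (H ν).smul_mem _ (bigR_mem ν (γ z) x hx))

lemma WTendsto.rho {γ : ℂ → GL (Fin n) ℂ} {ν : Fin n → ℕ} {L : ExtFamily n} {w : ℤ}
    (h : WTendsto (fun z => z ^ w • SeaUrchin.bigR ν (glCha (γ z))) (𝓝[≠] 0)
      (SeaUrchin.bigR ν L)) :
    WTendsto (fun z => z ^ w • SeaUrchin.rho ν (γ z)) (𝓝[≠] 0) (rhoExt ν L) := by
  have hinv := bigR_limit_mem h
  refine WTendsto.of_apply (s := Set.univ) Submodule.span_univ fun x _ φ => ?_
  obtain ⟨Φ, h2⟩ := exists_dual_extension φ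
  have h1 := h.apply x.1 Φ
  rw [h2, rhoExt, dif_pos hinv]
  refine h1.congr fun z => ?_
  rw [h2]
  rfl

lemma exists_GL_toLin' (α : V n ≃ₗ[ℂ] V n) :
    ∃ g : GL (Fin n) ℂ, Matrix.toLin' (g : Matrix (Fin n) (Fin n) ℂ) = α := by
  refine ⟨⟨LinearMap.toMatrix' (α : V n →ₗ[ℂ] V n), LinearMap.toMatrix' (α.symm : V n →ₗ[ℂ] V n),
    ?_, ?_⟩, ?_⟩
  · rw [← LinearMap.toMatrix'_comp]
    simp
  · rw [← LinearMap.toMatrix'_comp]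
    simp
  · simp

/-- In degree j + 1 the initial monomial in the vectors β⁻¹e_i is admissible for the level m_j and
goes to the initial monomial in the αe_i. Hence β⁻¹Ξ is sent to αΞ, which is nonzero because α is
invertible. -/
lemma rhoExt_ne_zero {α β : V n ≃ₗ[ℂ] V n} {m : Fin n → ℤ} (hm : Antitone m) {ν : Fin n → ℕ}
    {L : ExtFamily n}
    (hL : ∀ j : Fin n, L ((j : ℕ) + 1) = limitOp α β m (m j) ((j : ℕ) + 1))
    (hinv : ∀ x ∈ H ν, bigR ν L x ∈ H ν) : rhoExt ν L ≠ 0 := by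
  intro h
  rw [rhoExt, dif_pos hinv] at h
  obtain ⟨g, hg⟩ := exists_GL_toLin' β.symm
  obtain ⟨g', hg'⟩ := exists_GL_toLin' α
  have hx : bigR ν (glCha g) (bigXi ν) ∈ H ν := Submodule.subset_span ⟨g, rfl⟩
  have h0 : bigR ν L (bigR ν (glCha g) (bigXi ν)) = 0 :=
    congrArg Subtype.val (LinearMap.congr_fun h ⟨_, hx⟩)
  have h1 : bigR ν L (bigR ν (glCha g) (bigXi ν)) = bigR ν (glCha g') (bigXi ν) := by
    unfold bigR bigXi
    rw [PiTensorProduct.map_tprod, PiTensorProduct.map_tprod, PiTensorProduct.map_tprod]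
    congr 1
    funext x
    have hact := (actsBy_limitOp α β m (m x.1)).apply_castLE
      ((numGT_apply_le hm x.1).trans (Nat.le_succ _)) (lt_numGE_apply hm x.1)
      (Nat.succ_le_of_lt x.1.isLt)
    rw [hL, glCha, glCha, lambdaCha, lambdaCha, hg, hg', xi, exteriorPower.map_apply_ιMulti,
      exteriorPower.map_apply_ιMulti]
    simp only [mapBasis_apply, one_smul] at hact
    exact hact
  rw [h1] at h0
  have h2 : bigR ν (glCha (g'⁻¹ * g')) (bigXi ν) = 0 := by
    rw [bigR_mul, Module.End.mul_apply, h0, map_zero]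
  rw [inv_mul_cancel, bigR_one] at h2
  exact bigXi_ne_zero ν h2

/-! ## Weights -/

section Weights

variable {ι : Type*} [Fintype ι] [Nonempty ι]

lemma weight_eq_maxWeight_iff (m : Fin n → ℤ) (ν : ι → Fin n → ℕ) (l : ι) :
    weight m (ν l) = maxWeight m ν ↔ ∀ l', weight m (ν l') ≤ weight m (ν l) := by
  unfold maxWeight
  constructor
  · intro h l'
    rw [h]
    exact Finset.le_sup' (fun l => weight m (ν l)) (Finset.mem_univ l')
  · intro h
    exact le_antisymm (Finset.le_sup' (fun l => weight m (ν l)) (Finset.mem_univ l))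
      (Finset.sup'_le _ _ fun l' _ => h l')

lemma weight_le_maxWeight (m : Fin n → ℤ) (ν : ι → Fin n → ℕ) (l : ι) :
    weight m (ν l) ≤ maxWeight m ν :=
  Finset.le_sup' (fun l => weight m (ν l)) (Finset.mem_univ l)

lemma exists_weight_eq_maxWeight (m : Fin n → ℤ) (ν : ι → Fin n → ℕ) :
    ∃ l, weight m (ν l) = maxWeight m ν := by
  obtain ⟨l, _, hl⟩ := Finset.exists_mem_eq_sup' Finset.univ_nonempty fun l => weight m (ν l)
  exact ⟨l, hl.symm⟩

/-- Division by a positive gcd preserves the order of the weights. If the gcd is 0, all exponents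
and all weights vanish, and every index attains the maximum on both sides. -/
lemma normalized_weight_eq_iff (m : Fin n → ℤ) (ν : ι → Fin n → ℕ) (l : ι) :
    weight (normalized m) (ν l) = maxWeight (normalized m) ν ↔
      weight m (ν l) = maxWeight m ν := by
  set g := Finset.univ.gcd m with hg
  have hg0 : 0 ≤ g := by
    exact Int.nonneg_of_normalize_eq_self Finset.normalize_gcd
  have hfac : ∀ i, m i = g * normalized m i := fun i =>
    (Int.mul_ediv_cancel' (Finset.gcd_dvd (Finset.mem_univ i))).symm
  have hw : ∀ l, weight m (ν l) = g * weight (normalized m) (ν l) := by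
    intro l
    rw [weight, weight, Finset.mul_sum]
    refine Finset.sum_congr rfl fun i _ => ?_
    rw [hfac i, mul_assoc]
  rw [weight_eq_maxWeight_iff, weight_eq_maxWeight_iff]
  simp only [hw]
  rcases hg0.eq_or_lt with h0 | hpos
  · have hn : ∀ l, weight (normalized m) (ν l) = 0 := by
      intro l
      refine Finset.sum_eq_zero fun i _ => ?_
      rw [normalized, ← hg, ← h0]
      simp
    simp [hn]
  · simp [mul_le_mul_iff_right₀ hpos]

end Weights

/-! ## The limit hinge -/

lemma IsLimitHinge.limitHinge {γ : ℂ → GL (Fin n) ℂ} {m : Fin n → ℤ} (hm : Antitone m)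
    {a b : ℂ → Matrix (Fin n) (Fin n) ℂ} (ha : IsHolomorphicGerm a) (hb : IsHolomorphicGerm b)
    (hγ : ∀ᶠ z in 𝓝[≠] (0 : ℂ),
      (γ z : Matrix (Fin n) (Fin n) ℂ) = a z * Matrix.diagonal (fun i => z ^ (-m i)) * b z)
    {α β : V n ≃ₗ[ℂ] V n} (hα : ∀ x, α x = (a 0).mulVec x) (hβ : ∀ x, β x = (b 0).mulVec x)
    {K : ℕ} (hK : 0 < K) {k : Fin K → ℤ} (hk : StrictAnti k)
    (hr : Set.range k = Set.range m) :
    IsLimitHinge γ m (SeaUrchin.limitHinge α β hm hK k hk hr) :=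
  ⟨k, hk, hr, fun j => tendsto_limitRel α β hm ha hb hγ hα hβ (k j)⟩

/-- The set of exponents fixes the number of levels and their order; each relation is then a limit
in a Hausdorff space. -/
lemma IsLimitHinge.unique {γ : ℂ → GL (Fin n) ℂ} {m : Fin n → ℤ} {P P' : Hinge n}
    (h : IsLimitHinge γ m P) (h' : IsLimitHinge γ m P') : P = P' := by
  obtain ⟨K, hK, P, _, _, _, _, _⟩ := P
  obtain ⟨K', hK', P', _, _, _, _, _⟩ := P'
  obtain ⟨k, hk, hr, hlim⟩ := h
  obtain ⟨k', hk', hr', hlim'⟩ := h'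
  simp only at k hk hr hlim k' hk' hr' hlim'
  obtain rfl : K = K' := (StrictAnti.card_eq hk hr).trans (StrictAnti.card_eq hk' hr').symm
  obtain rfl : k = k' := StrictAnti.eq_of_range_eq hk hk' (hr.trans hr'.symm)
  obtain rfl : P = P' := funext fun j => tendsto_nhds_unique (hlim j) (hlim' j)
  rfl

/-! ## Convergence in the projective compactification -/

instance isModuleTopology_end (Z : Type*) [AddCommGroup Z] [Module ℂ Z] :
    IsModuleTopology ℂ (Module.End ℂ Z) := ⟨rfl⟩

lemma PMat.mk_smul {Z : Type*} [AddCommGroup Z] [Module ℂ Z] {A : Module.End ℂ Z} (hA : A ≠ 0)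
    {c : ℂ} (h : c • A ≠ 0) : PMat.mk (c • A) h = PMat.mk A hA := by
  have hc : c ≠ 0 := fun hc => h (by rw [hc, zero_smul])
  exact (Projectivization.mk_eq_mk_iff' ℂ _ _ h hA).2 ⟨c, rfl⟩

lemma PMat.tendsto_mk {Z α : Type*} [AddCommGroup Z] [Module ℂ Z] {l : Filter α}
    {f : α → Module.End ℂ Z} (hf : ∀ z, f z ≠ 0) {c : α → ℂ} (hc : ∀ᶠ z in l, c z ≠ 0)
    {A : Module.End ℂ Z} (hA : A ≠ 0) (h : Tendsto (fun z => c z • f z) l (𝓝 A)) :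
    Tendsto (fun z => PMat.mk (f z) (hf z)) l (𝓝 (PMat.mk A hA)) := by
  classical
  -- The rescaled family as a map into nonzero operators; the value A where c vanishes is eventually
  -- unused.
  let F : α → {A : Module.End ℂ Z // A ≠ 0} := fun z =>
    if hz : c z ≠ 0 then ⟨c z • f z, smul_ne_zero hz (hf z)⟩ else ⟨A, hA⟩
  have hF : Tendsto F l (𝓝 ⟨A, hA⟩) := by
    rw [tendsto_subtype_rng]
    refine h.congr' (hc.mono fun z hz => ?_)
    simp only [F, dif_pos hz]
  have hcont : Continuous fun A : {A : Module.End ℂ Z // A ≠ 0} => PMat.mk A.1 A.2 :=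
    continuous_coinduced_rng
  refine ((hcont.tendsto _).comp hF).congr' (hc.mono fun z hz => ?_)
  simp only [Function.comp_apply, F, dif_pos hz]
  exact PMat.mk_smul _ _

section Zeta

variable {ι : Type*} [Fintype ι] [Nonempty ι]

lemma zetaHinge_eq (ν : ι → Fin n → ℕ) (m : Fin n → ℤ) (P : Hinge n) :
    zetaHinge ν (normalized m) P = LinearMap.piMap fun l =>
      if weight m (ν l) = maxWeight m ν then rhoExt (ν l) P.lift else 0 := by
  unfold zetaHinge
  congr 1
  funext l
  simp only [normalized_weight_eq_iff]

lemma WTendsto.zeta_component {ν : ι → Fin n → ℕ} (hν : ∀ l, Antitone (ν l))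
    {γ : ℂ → GL (Fin n) ℂ} {m : Fin n → ℤ} {L : ExtFamily n}
    (hL : ∀ j : Fin n, WTendsto (fun z => z ^ partialSum m ((j : ℕ) + 1) • glCha (γ z) ((j : ℕ) + 1))
      (𝓝[≠] 0) (L ((j : ℕ) + 1))) (l : ι) :
    WTendsto (fun z => z ^ maxWeight m ν • SeaUrchin.rho (ν l) (γ z)) (𝓝[≠] 0)
      (if weight m (ν l) = maxWeight m ν then rhoExt (ν l) L else 0) := by
  have hl := WTendsto.rho (WTendsto.bigR hL (hν l))
  split_ifs with heq
  · rwa [heq] at hl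
  · have hpos : 0 < maxWeight m ν - weight m (ν l) :=
      sub_pos.2 (lt_of_le_of_ne (weight_le_maxWeight m ν l) heq)
    -- A summand of smaller weight converges under its own power of z; the surplus positive power
    -- sends it to 0.
    have h2 := WTendsto.smul (tendsto_pow_toNat hpos) hl
    rw [zero_smul] at h2
    refine h2.congr' ?_
    filter_upwards [self_mem_nhdsWithin] with z hz
    rw [smul_smul, ← zpow_natCast, Int.toNat_of_nonneg hpos.le, ← zpow_add₀ hz, sub_add_cancel]

omit [Fintype ι] [Nonempty ι] in
lemma smul_zeta (ν : ι → Fin n → ℕ) (c : ℂ) (g : GL (Fin n) ℂ) :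
    c • SeaUrchin.zeta ν g = LinearMap.piMap fun l => c • SeaUrchin.rho (ν l) g := rfl

lemma WTendsto.zeta {ν : ι → Fin n → ℕ} (hν : ∀ l, Antitone (ν l)) {γ : ℂ → GL (Fin n) ℂ}
    {m : Fin n → ℤ} {P : Hinge n}
    (hL : ∀ j : Fin n, WTendsto (fun z => z ^ partialSum m ((j : ℕ) + 1) • glCha (γ z) ((j : ℕ) + 1))
      (𝓝[≠] 0) (P.lift ((j : ℕ) + 1))) :
    WTendsto (fun z => z ^ maxWeight m ν • SeaUrchin.zeta ν (γ z)) (𝓝[≠] 0)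
      (zetaHinge ν (normalized m) P) := by
  rw [zetaHinge_eq]
  simp only [smul_zeta]
  exact WTendsto.piMap (WTendsto.zeta_component hν hL)

lemma zetaHinge_ne_zero {ν : ι → Fin n → ℕ} {m : Fin n → ℤ} (hm : Antitone m) {P : Hinge n}
    {α β : V n ≃ₗ[ℂ] V n}
    (hL : ∀ j : Fin n, P.lift ((j : ℕ) + 1) = limitOp α β m (m j) ((j : ℕ) + 1))
    (hinv : ∀ l, ∀ x ∈ H (ν l), bigR (ν l) P.lift x ∈ H (ν l)) :
    zetaHinge ν (normalized m) P ≠ 0 := by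
  classical
  rw [zetaHinge_eq]
  intro h
  obtain ⟨l, hl⟩ := exists_weight_eq_maxWeight m ν
  refine rhoExt_ne_zero hm hL (hinv l) (LinearMap.ext fun x => ?_)
  have h2 := congrFun (LinearMap.congr_fun h (Pi.single l x)) l
  simpa [hl] using h2

end Zeta

end

end SeaUrchin

end
-- Assembly of the limit theorem
open SeaUrchin in
theorem lemma3p6 {n : ℕ} (hn : 1 ≤ n) {ι : Type*} [Fintype ι] [Nonempty ι]
    (ν : ι → Fin n → ℕ) (hν : ∀ l, Antitone (ν l))
    (γ : ℂ → GL (Fin n) ℂ) (hγ : IsMeromorphicFamily γ) :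
    (∃! m : Fin n → ℤ, IsExponents γ m) ∧
    ∀ m : Fin n → ℤ, IsExponents γ m →
      (∃! P : Hinge n, IsLimitHinge γ m P) ∧
      ∀ P : Hinge n, IsLimitHinge γ m P →
        Tendsto (fun z : ℂ => z ^ maxWeight m ν • zeta ν (γ z)) (𝓝[≠] 0)
          (𝓝 (zetaHinge ν (normalized m) P)) ∧
        ∃ h : zetaHinge ν (normalized m) P ≠ 0,
          PMat.mk (zetaHinge ν (normalized m) P) h ∈ projCompactification ν ∧
          Tendsto (fun z : ℂ => zetaPoint ν (γ z)) (𝓝[≠] 0)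
            (𝓝 (PMat.mk (zetaHinge ν (normalized m) P) h)) := by
  obtain ⟨m₀, hm₀⟩ := exists_isExponents hγ
  refine ⟨⟨m₀, hm₀, fun m hm => hm.unique hm₀⟩, fun m hexp => ?_⟩
  obtain ⟨hm, a, b, ha, hb, hfac⟩ := hexp
  obtain ⟨α, hα⟩ := exists_linearEquiv_mulVec ha
  obtain ⟨β, hβ⟩ := exists_linearEquiv_mulVec hb
  obtain ⟨K, k, hK, hk, hr⟩ := exists_strictAnti_range hn m
  have hP₀ := IsLimitHinge.limitHinge hm ha hb hfac hα hβ hK hk hr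
  refine ⟨⟨_, hP₀, fun P hP => hP.unique hP₀⟩, fun P hP => ?_⟩
  -- Any limit hinge is the explicit one built from α and β, so its canonical family is known.
  obtain rfl := hP.unique hP₀
  have hlift : ∀ j : Fin n, (limitHinge α β hm hK k hk hr).lift ((j : ℕ) + 1) =
      limitOp α β m (m j) ((j : ℕ) + 1) := fun j =>
    lift_limitHinge α β hm hK hk hr hn ((numGT_apply_le hm j).trans (Nat.le_succ _))
      (lt_numGE_apply hm j)
  have hL : ∀ j : Fin n, WTendsto
      (fun z => z ^ partialSum m ((j : ℕ) + 1) • glCha (γ z) ((j : ℕ) + 1))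
      (𝓝[≠] 0) ((limitHinge α β hm hK k hk hr).lift ((j : ℕ) + 1)) := fun j => by
    rw [hlift]
    exact WTendsto.lambdaCha α β hm ha hb hfac hα hβ
      ((numGT_apply_le hm j).trans (Nat.le_succ _)) (lt_numGE_apply hm j)
  have hlim : Tendsto (fun z : ℂ => z ^ maxWeight m ν • zeta ν (γ z)) (𝓝[≠] 0)
      (𝓝 (zetaHinge ν (normalized m) (limitHinge α β hm hK k hk hr))) := by
    have := finite_end (∀ l, H (ν l))
    exact WTendsto.tendsto (WTendsto.zeta hν hL)
  have hne := zetaHinge_ne_zero hm hlift fun l => bigR_limit_mem (WTendsto.bigR hL (hν l))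
  have hproj : Tendsto (fun z : ℂ => zetaPoint ν (γ z)) (𝓝[≠] 0)
      (𝓝 (PMat.mk (zetaHinge ν (normalized m) (limitHinge α β hm hK k hk hr)) hne)) := by
    refine PMat.tendsto_mk _ ?_ hne hlim
    filter_upwards [self_mem_nhdsWithin] with z hz
    exact zpow_ne_zero _ hz
  exact ⟨hlim, hne, mem_closure_of_tendsto hproj (Eventually.of_forall fun z => ⟨γ z, rfl⟩), hproj⟩
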